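/- **Conventions.** A generator is a continuous non-increasing $\psi:[0,\infty]\to[0,1]$ with $\psi(0)=1$, $\psi(\infty)=0$, strictly decreasing on $[0,\inf\{t:\psi(t)=0\}]$. A function $f$ on $[0,\infty)$ is completely monotonic (c.m.) if it is $C^\infty$ on $[0,\infty)$ (one-sided at $0$) and $(-1)^kf^{(k)}\ge 0$ on $[0,\infty)$ for all $k\ge 0$. Let $\Psi_{+\infty}$ be the set of generators that are c.m. on $[0,\infty)$, and $\tilde\Psi^2_{+\infty}$ the set of pairs $(\psi_1,\psi_2)\in\Psi_{+\infty}^2$ with $\psi_1^{-1}\circ\psi_2$ differentiable on $[0,\infty)$ and $(\psi_1^{-1}\circ\psi_2)'$ c.m. The four families are $$\psi^{(A,\theta)}(t)=\frac{1-\theta}{e^t-\theta}\ (\theta\in[0,1)),\quad \psi^{(C,\theta)}(t)=(1+t)^{-1/\theta},\quad \psi^{(19,\theta)}(t)=\frac{\theta}{\ln(t+e^\theta)},\quad \psi^{(20,\theta)}(t)=\ln^{-1/\theta}(t+e)\quad(\theta\in(0,\infty)\text{ in the last three}),$$ and $\tau_{(a)}(\theta)=1-4\int_0^\infty t\,\big((\psi^{(a,\theta)})'(t)\big)^2dt$.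 For sets $N_1,N_2$ of pairs (family label, interval in $[0,\infty)$) put $N_1\tilde\cap N_2=\{(a,r_1\cap r_2):(a,r_1)\in N_1,(a,r_2)\in N_2\}$, and $(a,\theta)\,\tilde\in\,N$ iff $\theta\in r$ for some $(a,r)\in N$. Let $$N_0=\{(A,[0,1)),(C,[1,\infty)),(19,(0,\infty)),(20,[1,\infty))\}$$ and let $N^2(A,\theta)=\{(A,[0,\theta])\}$; $N^2(C,\theta)=\{(C,(0,\theta])\}$ if $\theta<1$ and $\{(A,[0,1)),(C,(0,\theta])\}$ if $\theta\ge1$; $N^2(19,\theta)=\{(A,[0,1)),(C,(0,1]),(19,(0,\theta])\}$; $N^2(20,\theta)=\{(C,(0,\theta]),(20,(0,\theta])\}$ if $\theta<1$ and $\{(A,[0,1)),(C,(0,\theta]),(20,(0,\theta])\}$ if $\theta\ge1$. **Computing system.** A finite set $M\subset\mathbb R$ of representable numbers is fixed, containing $0$, $1$ and a number strictly between them; $1-\epsilon$ is the largest element of $M$ below $1$. For an interval $r$, $\mathrm{trim}(\theta,r)=\max\{\min\{\theta,\beta\},\alpha\}$, where $[\alpha,\beta]$ is $r$ with an excluded left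 end replaced by the next larger element of $M$, an excluded finite right end by the next smaller element of $M$, and a right end $+\infty$ by $\max M$. **Algorithm.** Input: integers $d,n\ge2$; an array $(U_{mi})$, $m\le n$, $i\le d$, of real numbers (in particular, pseudo-observations); a $[0,\infty)$-aggregation function $g$ (for each $k\geq 1$ an exchangeable function $[0,\infty)^k\to[0,\infty)$ with $g(x,\dots,x)=x$); a $[0,\infty)$-valued statistic $S$ of a pair of columns and a bivariate Archimedean copula $C_\psi(u,v)=\psi(\psi^-(u)+\psi^-(v))$, $\psi^-(s)=\inf\{t:\psi(t)=s\}$. Ties in the maximization and minimization below are broken by arbitrary rules. *Structure.* Let $\tau^n_{ij}=\frac{4}{n(n-1)}\#\{k<l:(U_{ki}-U_{li})(U_{kj}-U_{lj})>0\}-1$. Start with the active nodes $1,\dots,d$. For $k=1,\dots,d-1$ choose active $i<j$ maximizing the average $D_{ij}$ of $\tau^n$ over $\downarrow\!(i)\times\downarrow\!(j)$, where $\downarrow\!(v)\subseteq\{1,\dots,d\}$ is the set of leaves below or equal to $v$; make $i,j$ the children of the new fork $d+k$, put $\hat\tau_{d+k}=D_{ij}$, deactivate $i,j$ and activate $d+k$.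 This gives $(\hat V,\hat E)$ with $\hat V=\{1,\dots,2d-1\}$. *Labeling.* Put $N^1(v)=N_0$ for every leaf $v$. For $k=1,\dots,d-1$ let $i<j$ be the children of $d+k$ and $N=N^1(i)\tilde\cap N^1(j)$; stop without result if $N=\emptyset$. For every $(a,r)\in N$ let $\hat\theta_{(a,r)}=\mathrm{trim}(\theta,r)$, where $\theta=\tau_{(a)}^{-1}(\hat\tau_{d+k})$, except that $\theta=0$ if $a=A$, $\hat\tau_{d+k}<0$; $\theta=1-\epsilon$ if $a=A$, $\hat\tau_{d+k}\ge\frac13$; $\theta=\epsilon$ if $a=19$, $\hat\tau_{d+k}\le\frac13$ or if $a\in\{C,20\}$, $\hat\tau_{d+k}<0$; and $\theta$ is an arbitrary real number in any remaining case where the inverse does not exist. Choose $(a,r)\in N$ minimizing the aggregate by $g$ of the values of $S$ at the column pairs in $\downarrow\!(i)\times\downarrow\!(j)$ and the copula $C_\psi$ with $\psi=\psi^{(a,\hat\theta_{(a,r)})}$; for the chosen pair set $\hat\lambda(d+k)=\psi^{(a,\hat\theta_{(a,r)})}$ and $N^1(d+k)=N\tilde\cap N^2(a,\hat\theta_{(a,r)})$;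 stop without result if $N^1(d+k)=\emptyset$. **Theorem.** For all inputs, all tie-breaking rules and all computing systems, the algorithm never stops without a result; it returns a triplet $(\hat V,\hat E,\hat\lambda)$ such that $(\hat V,\hat E)$ is a binary tree with leaves $1,\dots,d$, forks $d+1,\dots,2d-1$ and root $2d-1$, $\hat\lambda$ maps the forks into $\Psi_{+\infty}$, and the sufficient nesting condition holds: $(\hat\lambda(v),\hat\lambda(w))\in\tilde\Psi^2_{+\infty}$ for every fork $v$ and every child $w$ of $v$ that is a fork. Moreover, the non-emptiness condition holds through the family A: for all $(a_2,\theta_2)\,\tilde\in\,N_0$ and $(a_3,\theta_3)\,\tilde\in\,N_0$ there is $\theta_1\ge0$ with $(A,\theta_1)\,\tilde\in\,N_0\tilde\cap N^2(a_2,\theta_2)\tilde\cap N^2(a_3,\theta_3)$. -/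

import Mathlib

open scoped ContDiff

noncomputable section

namespace HAC

open scoped Classical

/-! ### Archimedean generators and Kendall's tau -/

/-- The restriction to `[0, ∞)` of a function on `[0, ∞]`, as a function of a real variable. -/
def onReal (ψ : ENNReal → ℝ) (t : ℝ) : ℝ := ψ (ENNReal.ofReal t)

/-- An Archimedean generator `ψ : [0, ∞] → [0, 1]`. Continuity on `[0, ∞]` contains
`ψ(∞) = lim_{t → ∞} ψ(t)`. -/
structure IsGenerator (ψ : ENNReal → ℝ) : Prop where
  mapsTo : ∀ t, ψ t ∈ Set.Icc (0 : ℝ) 1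
  continuous : Continuous ψ
  antitone : Antitone ψ
  map_zero : ψ 0 = 1
  map_top : ψ ⊤ = 0
  strictAntiOn : StrictAntiOn ψ (Set.Icc 0 (sInf {t | ψ t = 0}))

/-- Complete monotonicity on `[0, ∞)` (with one-sided derivatives at `0`). -/
def IsCM (f : ℝ → ℝ) : Prop :=
  ContDiffOn ℝ ∞ f (Set.Ici 0) ∧
    ∀ k : ℕ, ∀ t : ℝ, 0 ≤ t → 0 ≤ (-1) ^ k * iteratedDerivWithin k f (Set.Ici 0) t

/-- The set of completely monotonic Archimedean generators. -/
def CMGenerators : Set (ENNReal → ℝ) := {ψ | IsGenerator ψ ∧ IsCM (onReal ψ)}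

/-- The generalized inverse `ψ⁻(s) = inf {t | ψ(t) = s}`. -/
def genInv (ψ : ENNReal → ℝ) (s : ℝ) : ENNReal := sInf {t | ψ t = s}

/-- The bivariate Archimedean copula `C_ψ(u, v) = ψ(ψ⁻(u) + ψ⁻(v))`. -/
def archCopula (ψ : ENNReal → ℝ) (u v : unitInterval) : ℝ :=
  ψ (genInv ψ u + genInv ψ v)

/-- The function `ψ₁⁻¹ ∘ ψ₂` on `[0, ∞)`. -/
def genComp (ψ₁ ψ₂ : ENNReal → ℝ) (t : ℝ) : ℝ := (genInv ψ₁ (onReal ψ₂ t)).toReal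

/-- The pairs `(ψ₁, ψ₂)` of completely monotonic generators such that `ψ₁⁻¹ ∘ ψ₂` is
differentiable and `(ψ₁⁻¹ ∘ ψ₂)'` is completely monotonic on `[0, ∞)`. -/
def NestablePairs : Set ((ENNReal → ℝ) × (ENNReal → ℝ)) :=
  {p | p.1 ∈ CMGenerators ∧ p.2 ∈ CMGenerators ∧
    DifferentiableOn ℝ (genComp p.1 p.2) (Set.Ici 0) ∧
    IsCM (derivWithin (genComp p.1 p.2) (Set.Ici 0))}

/-- The labels of the four families A (Ali-Mikhail-Haq), C (Clayton), 19 and 20. -/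
inductive Family where
  | A | C | N19 | N20

/-- The parameter range of a family. -/
def paramRange : Family → Set ℝ
  | .A => Set.Ico 0 1
  | .C => Set.Ioi 0
  | .N19 => Set.Ioi 0
  | .N20 => Set.Ioi 0

/-- The explicit form of the generator with parameter `θ` at a real argument `t ≥ 0`. -/
def genReal : Family → ℝ → ℝ → ℝ
  | .A, θ, t => (1 - θ) / (Real.exp t - θ)
  | .C, θ, t => (1 + t) ^ (-(1 / θ))
  | .N19, θ, t => θ / Real.log (t + Real.exp θ)
  | .N20, θ, t => Real.log (t + Real.exp 1) ^ (-(1 / θ))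

/-- The generator of family `a` with parameter `θ`, on `[0, ∞]`. -/
def gen (a : Family) (θ : ℝ) (t : ENNReal) : ℝ :=
  if t = ⊤ then 0 else genReal a θ t.toReal

/-- Kendall's tau of a generator, `1 - 4 ∫₀^∞ t ψ'(t)² dt`. -/
def kendallTau (ψ : ENNReal → ℝ) : ℝ :=
  1 - 4 * ∫ t in Set.Ioi (0 : ℝ), t * (deriv (onReal ψ) t) ^ 2

/-! ### Tree structures

Nodes are positive integers: `1, …, d` are the leaves, `d + 1, …, d + k` the forks and `d + k` is
the root. An edge `(v, w)` points from the parent `v` to the child `w`. -/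

/-- The children of the node `v`. -/
def children (E : Finset (ℕ × ℕ)) (v : ℕ) : Finset ℕ :=
  (E.filter fun e => e.1 = v).image Prod.snd

/-- The leaves among `1, …, d` that descend from `v` (just `v`, if `v` is itself a leaf). -/
def leavesBelow (d : ℕ) (E : Finset (ℕ × ℕ)) (v : ℕ) : Finset ℕ :=
  (Finset.Icc 1 d).filter fun w => Relation.ReflTransGen (fun x y => (x, y) ∈ E) v w

/-- `(V, E)` is a binary tree with leaves `1, …, d` and forks `d + 1, …, 2d - 1`, rooted in the
node `2d - 1`. -/
structure IsBinaryTree (d : ℕ) (V : Finset ℕ) (E : Finset (ℕ × ℕ)) : Prop where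
  nodes : V = Finset.Icc 1 (2 * d - 1)
  edges : E ⊆ V ×ˢ V
  root : ∀ u, (u, 2 * d - 1) ∉ E
  parent : ∀ v ∈ V, v ≠ 2 * d - 1 → ∃! u, (u, v) ∈ E
  connected : ∀ v ∈ V, Relation.ReflTransGen (fun x y => (x, y) ∈ E) (2 * d - 1) v
  leaf : ∀ v ∈ Finset.Icc 1 d, children E v = ∅
  fork : ∀ v ∈ Finset.Icc (d + 1) (2 * d - 1), (children E v).card = 2

/-- The sufficient nesting condition for a tree with edges `E`, leaves `1, …, d`, forks
`d + 1, …, d + k` and the labeling `lam` of the forks by generators. -/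
def SNC (d k : ℕ) (E : Finset (ℕ × ℕ)) (lam : ℕ → ENNReal → ℝ) : Prop :=
  ∀ v ∈ Finset.Icc (d + 1) (d + k), ∀ w ∈ children E v ∩ Finset.Icc (d + 1) (d + k),
    (lam v, lam w) ∈ NestablePairs

/-! ### The nesting semigroup -/

/-- The intervals `[α, β]`, `(α, β]`, `[α, β)`, `(α, β)` with `0 ≤ α < ∞` and `α ≤ β ≤ ∞`, as sets
of real parameters. -/
def ranges : Set (Set ℝ) :=
  {r | ∃ α : ℝ, 0 ≤ α ∧
    (r = Set.Ici α ∨ r = Set.Ioi α ∨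
      ∃ β : ℝ, α ≤ β ∧
        (r = Set.Icc α β ∨ r = Set.Ioc α β ∨ r = Set.Ico α β ∨ r = Set.Ioo α β))}

/-- The intersection operation on sets of pairs (family label, parameter interval). -/
def nestInter (N₁ N₂ : Set (Family × Set ℝ)) : Set (Family × Set ℝ) :=
  {p | ∃ r₁ ∈ ranges, ∃ r₂ ∈ ranges, r₁ ∩ r₂ = p.2 ∧ (p.1, r₁) ∈ N₁ ∧ (p.1, r₂) ∈ N₂}

/-- The relation "`(a, θ)` is represented by `N`". -/
def NestMem (a : Family) (θ : ℝ) (N : Set (Family × Set ℝ)) : Prop :=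
  ∃ r ∈ ranges, (a, r) ∈ N ∧ θ ∈ r

/-- The admissible pairs for the leaves. -/
def N0 : Set (Family × Set ℝ) :=
  {(.A, Set.Ico 0 1), (.C, Set.Ici 1), (.N19, Set.Ioi 0), (.N20, Set.Ici 1)}

/-- The explicit mapping sending a child `(a, θ)` to its admissible parents. -/
def N2 : Family → ℝ → Set (Family × Set ℝ)
  | .A, θ => {(.A, Set.Icc 0 θ)}
  | .C, θ => if θ < 1 then {(.C, Set.Ioc 0 θ)} else {(.A, Set.Ico 0 1), (.C, Set.Ioc 0 θ)}
  | .N19, θ => {(.A, Set.Ico 0 1), (.C, Set.Ioc 0 1), (.N19, Set.Ioc 0 θ)}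
  | .N20, θ =>
      if θ < 1 then {(.C, Set.Ioc 0 θ), (.N20, Set.Ioc 0 θ)}
      else {(.A, Set.Ico 0 1), (.C, Set.Ioc 0 θ), (.N20, Set.Ioc 0 θ)}

/-! ### Machine numbers, inversion of Kendall's tau and trimming -/

/-- A computing system, given by its finite set of representable real numbers; `0`, `1` and some
number strictly between them are representable. -/
structure MachineReals where
  carrier : Finset ℝ
  zero_mem : 0 ∈ carrier
  one_mem : 1 ∈ carrier
  exists_between : ∃ x ∈ carrier, 0 < x ∧ x < 1

/-- The smallest representable number above `x` (`x` itself if there is none). -/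
def MachineReals.next (M : MachineReals) (x : ℝ) : ℝ :=
  if h : (M.carrier.filter fun y => x < y).Nonempty then
    (M.carrier.filter fun y => x < y).min' h else x

/-- The largest representable number below `x` (`x` itself if there is none). -/
def MachineReals.prev (M : MachineReals) (x : ℝ) : ℝ :=
  if h : (M.carrier.filter fun y => y < x).Nonempty then
    (M.carrier.filter fun y => y < x).max' h else x

/-- The largest representable number. -/
def MachineReals.largest (M : MachineReals) : ℝ := M.carrier.max' ⟨0, M.zero_mem⟩

/-- The number `ε` such that `1 - ε` is the largest representable number below `1`. -/
def MachineReals.eps (M : MachineReals) : ℝ := 1 - M.prev 1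

/-- `trim(θ, r) = max (min θ β) α`, where `[α, β]` is `r` with each end that does not belong to `r`
replaced by the next representable number inside (for an unbounded `r`, `β` is the largest
representable number). -/
def trim (M : MachineReals) (θ : ℝ) (r : Set ℝ) : ℝ :=
  let α := if sInf r ∈ r then sInf r else M.next (sInf r)
  let β := if BddAbove r then (if sSup r ∈ r then sSup r else M.prev (sSup r)) else M.largest
  max (min θ β) α

/-- The parameter of family `a` with Kendall's tau equal to `τ`. If there is none, the value is
that of the function `fallback`. -/
def tauInv (fallback : Family → ℝ → ℝ) (a : Family) (τ : ℝ) : ℝ :=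
  if h : ∃ θ ∈ paramRange a, kendallTau (gen a θ) = τ then h.choose else fallback a τ

/-- The parameter estimate for family `a` obtained from an estimate `τ` of Kendall's tau, with the
prescribed values for `τ` too small or too large for the family. The function `fallback` is only
reached for the values that these rules leave open (`τ = 0` for C and 20 and `τ = 1` for C, 19
and 20). -/
def paramEstimate (M : MachineReals) (fallback : Family → ℝ → ℝ) : Family → ℝ → ℝ
  | .A, τ => if τ < 0 then 0 else if 1 / 3 ≤ τ then 1 - M.eps else tauInv fallback .A τ
  | .C, τ => if τ < 0 then M.eps else tauInv fallback .C τ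
  | .N19, τ => if τ ≤ 1 / 3 then M.eps else tauInv fallback .N19 τ
  | .N20, τ => if τ < 0 then M.eps else tauInv fallback .N20 τ

/-! ### Data, aggregation functions and goodness-of-fit statistics

The data are an array `U m i` with rows `m` and columns `i = 1, …, d`; other columns are not
used. -/

/-- The sample version of Kendall's tau of the columns `i` and `j`. -/
def sampleTau {n : ℕ} (U : Fin n → ℕ → ℝ) (i j : ℕ) : ℝ :=
  4 / ((n : ℝ) * ((n : ℝ) - 1)) *
    (((Finset.univ : Finset (Fin n × Fin n)).filter fun p =>
      p.1 < p.2 ∧ 0 < (U p.1 i - U p.2 i) * (U p.1 j - U p.2 j)).card : ℝ) - 1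

/-- The average of `T i j` over `(i, j) ∈ I × J`. -/
def avg (T : ℕ → ℕ → ℝ) (I J : Finset ℕ) : ℝ :=
  (∑ p ∈ I ×ˢ J, T p.1 p.2) / ((I ×ˢ J).card : ℝ)

/-- A `[0, ∞)`-aggregation function (of any number of arguments). -/
def IsAggregation (g : (k : ℕ) → (Fin k → NNReal) → NNReal) : Prop :=
  (∀ k, 0 < k → ∀ x : NNReal, g k (fun _ => x) = x) ∧
    ∀ k (x : Fin k → NNReal) (σ : Equiv.Perm (Fin k)), g k (fun q => x (σ q)) = g k x

/-- The `g`-aggregated statistic: the values of the statistic `S` at the pairs of columns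
`(i₁, j₁), (i₁, j₂), …, (i_m, j_q)` with indices in `I × J`, aggregated by `g`. For one-element
sets this is the value of `S` at the single pair, since `g` maps `(x, …, x)` to `x`. -/
def aggStat {n : ℕ} (U : Fin n → ℕ → ℝ) (g : (k : ℕ) → (Fin k → NNReal) → NNReal)
    (S : (Fin n → ℝ × ℝ) → (unitInterval → unitInterval → ℝ) → NNReal)
    (I J : Finset ℕ) (ψ : ENNReal → ℝ) : NNReal :=
  let l : List (ℕ × ℕ) := I.sort ×ˢ J.sort
  g l.length fun q => S (fun m => (U m (l.get q).1, U m (l.get q).2)) (archCopula ψ)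

/-- A rule choosing, in the `k`-th loop, one element of a nonempty set; used to break ties. -/
def IsSelection {α : Type} (sel : ℕ → Set α → α) : Prop :=
  ∀ k s, s.Nonempty → sel k s ∈ s

/-! ### Estimation of the structure -/

/-- The variables of the structure estimation: the nodes still to be joined, the edges found so
far and the estimates of Kendall's tau of the forks found so far. -/
structure StructState where
  active : Finset ℕ
  edges : Finset (ℕ × ℕ)
  tau : ℕ → ℝ

/-- The `k`-th loop: join the pair of active nodes with the largest average of `T` into the fork
`d + k`. -/
def structStep (d : ℕ) (T : ℕ → ℕ → ℝ) (selPair : ℕ → Set (ℕ × ℕ) → ℕ × ℕ) (k : ℕ)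
    (s : StructState) : StructState :=
  let D : ℕ × ℕ → ℝ := fun p => avg T (leavesBelow d s.edges p.1) (leavesBelow d s.edges p.2)
  let cand : Set (ℕ × ℕ) := {p | p.1 ∈ s.active ∧ p.2 ∈ s.active ∧ p.1 < p.2}
  let p := selPair k {p | p ∈ cand ∧ ∀ q ∈ cand, D q ≤ D p}
  { active := (s.active ∪ {d + k}) \ {p.1, p.2}
    edges := s.edges ∪ {(d + k, p.1), (d + k, p.2)}
    tau := Function.update s.tau (d + k) (D p) }

/-- The state after the first `k` loops. -/
def structRun (d : ℕ) (T : ℕ → ℕ → ℝ) (selPair : ℕ → Set (ℕ × ℕ) → ℕ × ℕ) : ℕ → StructState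
  | 0 => { active := Finset.Icc 1 d, edges := ∅, tau := fun _ => 0 }
  | k + 1 => structStep d T selPair (k + 1) (structRun d T selPair k)

/-! ### Estimation of a heterogeneous hierarchical Archimedean copula -/

/-- The variables of the heterogeneous estimation: the admissible parents of each node and the
labels of the forks treated so far. -/
structure HeteroState where
  parents : ℕ → Set (Family × Set ℝ)
  lam : ℕ → ENNReal → ℝ

/-- The triplet returned by the estimation; `lam` is meaningful on the forks. -/
structure Triplet where
  V : Finset ℕ
  E : Finset (ℕ × ℕ)
  lam : ℕ → ENNReal → ℝ

/-- The `k`-th loop; `none` means that the algorithm stops without a result. Here `E` and `tau` come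
from the structure estimation, `stat I J ψ` is the aggregated goodness-of-fit statistic and
`est a τ` the estimate of the parameter of family `a`. -/
def heteroStep (d : ℕ) (E : Finset (ℕ × ℕ)) (tau : ℕ → ℝ)
    (n2 : Family → ℝ → Set (Family × Set ℝ))
    (stat : Finset ℕ → Finset ℕ → (ENNReal → ℝ) → NNReal)
    (M : MachineReals) (est : Family → ℝ → ℝ)
    (selFam : ℕ → Set (Family × Set ℝ) → Family × Set ℝ) (k : ℕ) (s : HeteroState) :
    Option HeteroState :=
  let i := sInf (children E (d + k) : Set ℕ)
  let j := sSup (children E (d + k) : Set ℕ)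
  let N := nestInter (s.parents i) (s.parents j)
  if N = ∅ then none else
    let θ : Family × Set ℝ → ℝ := fun p => trim M (est p.1 (tau (d + k))) p.2
    let score : Family × Set ℝ → NNReal := fun p =>
      stat (leavesBelow d E i) (leavesBelow d E j) (gen p.1 (θ p))
    let best := selFam k {p | p ∈ N ∧ ∀ q ∈ N, score p ≤ score q}
    let N' := nestInter N (n2 best.1 (θ best))
    if N' = ∅ then none else
      some { parents := Function.update s.parents (d + k) N'
             lam := Function.update s.lam (d + k) (gen best.1 (θ best)) }

/-- The state after the first `k` loops; initially the leaves have the admissible parents `n0`. -/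
def heteroRun (d : ℕ) (E : Finset (ℕ × ℕ)) (tau : ℕ → ℝ)
    (n0 : Set (Family × Set ℝ)) (n2 : Family → ℝ → Set (Family × Set ℝ))
    (stat : Finset ℕ → Finset ℕ → (ENNReal → ℝ) → NNReal)
    (M : MachineReals) (est : Family → ℝ → ℝ)
    (selFam : ℕ → Set (Family × Set ℝ) → Family × Set ℝ) : ℕ → Option HeteroState
  | 0 => some { parents := fun v => if v ∈ Finset.Icc 1 d then n0 else ∅, lam := fun _ _ => 0 }
  | k + 1 => (heteroRun d E tau n0 n2 stat M est selFam k).bind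
      (heteroStep d E tau n2 stat M est selFam (k + 1))

/-- The heterogeneous estimation algorithm. Inputs: the data `U`, the sets `n0` and `n2`, the
aggregation function `g` and the statistic `S`. The remaining arguments are the computing system,
the `fallback` values of the inversion of Kendall's tau and the rules for breaking ties. -/
def heteroHAC (d : ℕ) {n : ℕ} (U : Fin n → ℕ → ℝ)
    (n0 : Set (Family × Set ℝ)) (n2 : Family → ℝ → Set (Family × Set ℝ))
    (g : (k : ℕ) → (Fin k → NNReal) → NNReal)
    (S : (Fin n → ℝ × ℝ) → (unitInterval → unitInterval → ℝ) → NNReal)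
    (M : MachineReals) (fallback : Family → ℝ → ℝ)
    (selPair : ℕ → Set (ℕ × ℕ) → ℕ × ℕ)
    (selFam : ℕ → Set (Family × Set ℝ) → Family × Set ℝ) : Option Triplet :=
  let st := structRun d (sampleTau U) selPair (d - 1)
  (heteroRun d st.edges st.tau n0 n2 (aggStat U g S) M (paramEstimate M fallback) selFam
    (d - 1)).map fun s =>
      { V := Finset.Icc 1 (2 * d - 1), E := st.edges, lam := s.lam }

end HAC

end

/-! Two things are needed: every parent offered by `N0` and `N2` to a child produced by the
algorithm is nestable, and the sets of admissible parents never become empty.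

Nestability says that h = ψ₁⁻¹ ∘ ψ₂ is a Bernstein function, regular up to 0 (`HasCMDeriv`). These
functions are stable under h ↦ log(1 + h) and h ↦ (1 + h)^q - 1 with 0 ≤ q ≤ 1, which settles A and
C as parents of the other families and C over C; A over A and 19 over 19 have an explicit h of the
same kind. The hard case is 20 over 20, where h = exp(L^a) - e with L = log(t + e) and 0 < a < 1.
With p = 1 - a, minus the logarithmic derivative of h' is exp(-L) F(L), F(x) = 1 + p/x - (1 -
p)x^(-p). Its k-th derivative in t has, up to (-1)^k, the sign of ∏_{m ≤ k} (1 - m⁻¹ d/dx) F at x =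
L. Laplace transforms turn these operators into multiplication of a density by ∏ (1 + s/m).
`twentyAux_nonneg` proves positivity by a direct estimate while the harmonic number is at most 1 +
x, and by monotonicity in k afterwards.

For the algorithm, all intervals met are initial parts of those in `N0` (`IsAdmissible`), and
trimming always lands inside them (`trim_mem`). Family A survives every intersection because each
`N2` offers it with an interval containing 0. The label of a new fork is taken from the common
admissible parents of its two children, so it nests with both (`HeteroInv.succ`). -/

noncomputable section

namespace HAC

section

open Set

/-! ### Complete monotonicity up to a finite order -/

/-- Complete monotonicity of order `n` on `[0, ∞)`, by recursion on minus the derivative. -/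
def CMn : ℕ → (ℝ → ℝ) → Prop
  | 0, f => ∀ t, 0 ≤ t → 0 ≤ f t
  | n + 1, f => (∀ t, 0 ≤ t → 0 ≤ f t) ∧
      ∃ g : ℝ → ℝ, (∀ t, 0 ≤ t → HasDerivWithinAt f (-g t) (Ici 0) t) ∧ CMn n g

lemma CMn.nonneg {n : ℕ} {f : ℝ → ℝ} (h : CMn n f) {t : ℝ} (ht : 0 ≤ t) : 0 ≤ f t := by
  cases n with
  | zero => exact h t ht
  | succ n => exact h.1 t ht

lemma CMn.of_succ {n : ℕ} {f : ℝ → ℝ} (h : CMn (n + 1) f) : CMn n f := by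
  induction n generalizing f with
  | zero => exact h.1
  | succ n ih =>
    obtain ⟨h0, g, hg, hn⟩ := h
    exact ⟨h0, g, hg, ih hn⟩

lemma CMn.congr {n : ℕ} {f g : ℝ → ℝ} (h : CMn n f) (hfg : ∀ t, 0 ≤ t → g t = f t) :
    CMn n g := by
  cases n with
  | zero => intro t ht; rw [hfg t ht]; exact h t ht
  | succ n =>
    obtain ⟨h0, f', hf', hn⟩ := h
    refine ⟨fun t ht => by rw [hfg t ht]; exact h0 t ht, f', fun t ht => ?_, hn⟩
    exact (hf' t ht).congr (fun x hx => hfg x hx) (hfg t ht)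

lemma CMn.zero_fun (n : ℕ) : CMn n fun _ => 0 := by
  induction n with
  | zero => intro t _; exact le_rfl
  | succ n ih => exact ⟨fun _ _ => le_rfl, fun _ => 0, fun t _ => by
      simpa using hasDerivWithinAt_const t (Ici (0 : ℝ)) (0 : ℝ), ih⟩

lemma CMn.const (n : ℕ) {c : ℝ} (hc : 0 ≤ c) : CMn n fun _ => c := by
  cases n with
  | zero => intro t _; exact hc
  | succ n => exact ⟨fun _ _ => hc, fun _ => 0, fun t _ => by
      simpa using hasDerivWithinAt_const t (Ici (0 : ℝ)) c, CMn.zero_fun n⟩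

lemma CMn.add {n : ℕ} {f g : ℝ → ℝ} (hf : CMn n f) (hg : CMn n g) :
    CMn n fun t => f t + g t := by
  induction n generalizing f g with
  | zero => intro t ht; exact add_nonneg (hf t ht) (hg t ht)
  | succ n ih =>
    obtain ⟨hf0, f', hf', hfn⟩ := hf
    obtain ⟨hg0, g', hg', hgn⟩ := hg
    refine ⟨fun t ht => add_nonneg (hf0 t ht) (hg0 t ht), _, fun t ht => ?_, ih hfn hgn⟩
    convert! (hf' t ht).add (hg' t ht) using 1
    ring

lemma CMn.mul {n : ℕ} {f g : ℝ → ℝ} (hf : CMn n f) (hg : CMn n g) :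
    CMn n fun t => f t * g t := by
  induction n generalizing f g with
  | zero => intro t ht; exact mul_nonneg (hf t ht) (hg t ht)
  | succ n ih =>
    have hf1 := hf.of_succ
    have hg1 := hg.of_succ
    obtain ⟨hf0, f', hf', hfn⟩ := hf
    obtain ⟨hg0, g', hg', hgn⟩ := hg
    refine ⟨fun t ht => mul_nonneg (hf0 t ht) (hg0 t ht), _, fun t ht => ?_,
      (ih hfn hg1).add (ih hf1 hgn)⟩
    convert! (hf' t ht).mul (hg' t ht) using 1
    ring

/-- A completely monotonic function composed with a nonnegative function whose derivative is
completely monotonic. -/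
lemma CMn.comp {n : ℕ} {f b b' : ℝ → ℝ} (hf : CMn n f) (hb : ∀ t, 0 ≤ t → 0 ≤ b t)
    (hb' : ∀ t, 0 ≤ t → HasDerivWithinAt b (b' t) (Ici 0) t) (hn : ∀ n, CMn n b') :
    CMn n fun t => f (b t) := by
  induction n generalizing f with
  | zero => intro t ht; exact hf _ (hb t ht)
  | succ n ih =>
    obtain ⟨hf0, f', hf', hfn⟩ := hf
    refine ⟨fun t ht => hf0 _ (hb t ht), _, fun t ht => ?_, (ih hfn).mul (hn n)⟩
    convert! (hf' (b t) (hb t ht)).comp t (hb' t ht) (fun x hx => hb x hx) using 1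
    ring

/-- A nonnegative function all of whose successive derivatives are, up to sign, products of itself
with completely monotonic functions. -/
lemma CMn.of_logDeriv {f g : ℝ → ℝ} (hf : ∀ t, 0 ≤ t → 0 ≤ f t)
    (hf' : ∀ t, 0 ≤ t → HasDerivWithinAt f (-(g t * f t)) (Ici 0) t) (hg : ∀ n, CMn n g)
    (n : ℕ) : CMn n f := by
  induction n with
  | zero => exact hf
  | succ n ih => exact ⟨hf, _, hf', (hg n).mul ih⟩

lemma CMn.rpow (n : ℕ) {c p : ℝ} (hc : 0 < c) (hp : 0 ≤ p) : CMn n fun t => (t + c) ^ (-p) := by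
  induction n generalizing p with
  | zero => intro t ht; positivity
  | succ n ih =>
    refine ⟨fun t ht => by positivity, fun t => p * (t + c) ^ (-(p + 1)), fun t ht => ?_,
      (CMn.const n hp).mul (ih (by linarith))⟩
    have h := ((hasDerivAt_id t).add_const c).rpow_const (p := -p)
      (Or.inl (by simp only [id]; positivity))
    convert! h.hasDerivWithinAt using 1
    simp only [id]
    rw [show -p - 1 = -(p + 1) by ring]
    ring

lemma CMn.exp_neg (n : ℕ) : CMn n fun t => Real.exp (-t) := by
  refine CMn.of_logDeriv (g := fun _ => 1) (fun t _ => (Real.exp_pos _).le) (fun t _ => ?_)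
    (fun n => CMn.const n zero_le_one) n
  convert! (hasDerivAt_neg t).exp.hasDerivWithinAt using 1
  ring

lemma CMn.isCM {f : ℝ → ℝ} (h : ∀ n, CMn n f) : IsCM f := by
  have uD := uniqueDiffOn_Ici (0 : ℝ)
  constructor
  · rw [contDiffOn_infty]
    intro n
    -- The order is off by one: `CMn n` gives no regularity of the n-th derivative, while one order
    -- more makes it differentiable, hence continuous.
    have key : ∀ n : ℕ, ∀ f, CMn (n + 1) f → ContDiffOn ℝ n f (Ici 0) := by
      intro n
      induction n with
      | zero =>
        rintro f ⟨-, g, hg, -⟩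
        exact contDiffOn_zero.2 fun t ht => (hg t ht).continuousWithinAt
      | succ n ih =>
        rintro f ⟨-, g, hg, hn⟩
        push_cast
        rw [contDiffOn_succ_iff_derivWithin uD]
        refine ⟨fun t ht => (hg t ht).differentiableWithinAt, by simp, ?_⟩
        refine (ih g hn).neg.congr fun t ht => ?_
        exact (hg t ht).derivWithin (uD t ht)
    exact key n f (h (n + 1))
  · intro k
    have key : ∀ k : ℕ, ∀ f, CMn k f → ∀ t : ℝ, 0 ≤ t →
        0 ≤ (-1) ^ k * iteratedDerivWithin k f (Ici 0) t := by
      intro k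
      induction k with
      | zero => intro f hf t ht; simpa using hf t ht
      | succ k ih =>
        rintro f ⟨-, g, hg, hn⟩ t ht
        have e : EqOn (derivWithin f (Ici 0)) (-g) (Ici 0) := fun t ht =>
          (hg t ht).derivWithin (uD t ht)
        rw [iteratedDerivWithin_succ', iteratedDerivWithin_congr e ht, iteratedDerivWithin_neg]
        have := ih g hn t ht
        rw [pow_succ]
        linarith
    exact key k f (h k)

end

section

open Set Filter Topology

/-! ### Functions with a completely monotonic derivative -/

/-- `h(0) = 0` and `h` has the completely monotonic derivative `h'` on `[0, ∞)`. -/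
structure HasCMDeriv (h h' : ℝ → ℝ) : Prop where
  map_zero : h 0 = 0
  deriv : ∀ t, 0 ≤ t → HasDerivWithinAt h (h' t) (Ici 0) t
  cm : ∀ n, CMn n h'

lemma HasCMDeriv.nonneg {h h' : ℝ → ℝ} (H : HasCMDeriv h h') {t : ℝ} (ht : 0 ≤ t) : 0 ≤ h t := by
  have := monotoneOn_of_hasDerivWithinAt_nonneg (f := h) (f' := h') (convex_Ici (0 : ℝ))
    (fun t ht => (H.deriv t ht).continuousWithinAt)
    (fun t ht => (H.deriv t (interior_subset ht)).mono interior_subset)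
    (fun t ht => (H.cm 0).nonneg (interior_subset ht))
  simpa [H.map_zero] using this (self_mem_Ici) ht ht

lemma HasCMDeriv.id : HasCMDeriv (fun t => t) (fun _ => 1) :=
  ⟨rfl, fun t _ => hasDerivWithinAt_id t _, fun n => CMn.const n zero_le_one⟩

lemma HasCMDeriv.const_mul {h h' : ℝ → ℝ} (H : HasCMDeriv h h') {c : ℝ} (hc : 0 ≤ c) :
    HasCMDeriv (fun t => c * h t) (fun t => c * h' t) :=
  ⟨by simp [H.map_zero], fun t ht => (H.deriv t ht).const_mul c,
    fun n => (CMn.const n hc).mul (H.cm n)⟩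

/-- This is the factor that the chain rule produces for log(1 + h) and (1 + h)^q, so both inherit a
completely monotonic derivative from h. -/
lemma HasCMDeriv.comp_rpow {h h' : ℝ → ℝ} (H : HasCMDeriv h h') {p : ℝ} (hp : 0 ≤ p) (n : ℕ) :
    CMn n fun t => (h t + 1) ^ (-p) :=
  (CMn.rpow n one_pos hp).comp (fun _ ht => H.nonneg ht) H.deriv H.cm

lemma HasCMDeriv.log_one_add {h h' : ℝ → ℝ} (H : HasCMDeriv h h') :
    HasCMDeriv (fun t => Real.log (h t + 1)) (fun t => h' t * (h t + 1) ^ (-1 : ℝ)) := by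
  refine ⟨by simp [H.map_zero], fun t ht => ?_, fun n => (H.cm n).mul (H.comp_rpow zero_le_one n)⟩
  have := H.nonneg ht
  convert! ((H.deriv t ht).add_const 1).log (by positivity) using 1
  rw [Real.rpow_neg_one]
  rfl

lemma HasCMDeriv.rpow {h h' : ℝ → ℝ} (H : HasCMDeriv h h') {q : ℝ} (hq : 0 ≤ q) (hq1 : q ≤ 1) :
    HasCMDeriv (fun t => (h t + 1) ^ q - 1) (fun t => q * (h' t * (h t + 1) ^ (-(1 - q)))) := by
  refine ⟨by simp [H.map_zero], fun t ht => ?_,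
    fun n => (CMn.const n hq).mul ((H.cm n).mul (H.comp_rpow (by linarith) n))⟩
  have := H.nonneg ht
  convert! (((H.deriv t ht).add_const 1).rpow_const (p := q)
    (Or.inl (by positivity))).sub_const 1 using 1
  rw [show -(1 - q) = q - 1 by ring]
  ring

lemma HasCMDeriv.log_add {c : ℝ} (hc : 0 < c) :
    HasCMDeriv (fun t => Real.log (t + c) - Real.log c) (fun t => (t + c) ^ (-1 : ℝ)) := by
  refine ⟨by simp, fun t ht => ?_, fun n => CMn.rpow n hc zero_le_one⟩
  convert! (((hasDerivAt_id t).add_const c).log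
    (by simp only [_root_.id]; positivity)).hasDerivWithinAt.sub_const (Real.log c) using 1
  rw [Real.rpow_neg_one]
  simp

lemma HasCMDeriv.rpow_add {c q : ℝ} (hc : 0 < c) (hq : 0 ≤ q) (hq1 : q ≤ 1) :
    HasCMDeriv (fun t => (t + c) ^ q - c ^ q) (fun t => q * (t + c) ^ (-(1 - q))) := by
  refine ⟨by simp, fun t ht => ?_,
    fun n => (CMn.const n hq).mul (CMn.rpow n hc (by linarith))⟩
  convert! (((hasDerivAt_id t).add_const c).rpow_const (p := q)
    (Or.inl (by simp only [_root_.id]; positivity))).hasDerivWithinAt.sub_const (c ^ q) using 1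
  rw [show -(1 - q) = q - 1 by ring]
  simp

lemma exp_sub_pos {k t : ℝ} (hk : k < 1) (ht : 0 ≤ t) : 0 < Real.exp t - k := by
  have := Real.one_le_exp ht
  linarith

/-- The function f solves the Riccati equation f' = -k exp(-t) f², whose right side is, up to sign,
a product of completely monotonic factors of one order less. -/
lemma CMn.exp_div_exp_sub {k : ℝ} (hk : 0 ≤ k) (hk1 : k < 1) (n : ℕ) :
    CMn n fun t => Real.exp t / (Real.exp t - k) := by
  induction n with
  | zero =>
    intro t ht
    have := exp_sub_pos hk1 ht
    positivity
  | succ n ih =>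
    refine ⟨fun t ht => ?_, _, fun t ht => ?_,
      ((CMn.const n hk).mul (CMn.exp_neg n)).mul (ih.mul ih)⟩
    · have := exp_sub_pos hk1 ht
      positivity
    · have h0 := exp_sub_pos hk1 ht
      convert! ((Real.hasDerivAt_exp t).div ((Real.hasDerivAt_exp t).sub_const k)
        h0.ne').hasDerivWithinAt using 1
      rw [Real.exp_neg]
      have := Real.exp_pos t
      field_simp
      ring

lemma HasCMDeriv.log_exp_sub {k : ℝ} (hk : 0 ≤ k) (hk1 : k < 1) :
    HasCMDeriv (fun t => Real.log (Real.exp t - k) - Real.log (1 - k))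
      (fun t => Real.exp t / (Real.exp t - k)) :=
  ⟨by simp, fun t ht => (((Real.hasDerivAt_exp t).sub_const k).log
    (exp_sub_pos hk1 ht).ne').hasDerivWithinAt.sub_const _, CMn.exp_div_exp_sub hk hk1⟩

/-! ### The four families consist of completely monotonic generators -/

/-- A strictly decreasing f with limit 0 stays positive, so the extension by 0 is strictly
decreasing on all of [0, ∞]; continuity at ∞ is the limit itself. -/
lemma isGenerator_of_real {f : ℝ → ℝ} (h0 : f 0 = 1) (hc : ContinuousOn f (Ici 0))
    (hs : StrictAntiOn f (Ici 0)) (hl : Tendsto f atTop (𝓝 0)) :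
    IsGenerator fun t : ENNReal => if t = ⊤ then 0 else f t.toReal := by
  have hanti : AntitoneOn f (Ici 0) := hs.antitoneOn
  have hnonneg : ∀ t, 0 ≤ t → 0 ≤ f t := fun t ht => le_of_tendsto hl <|
    (eventually_ge_atTop t).mono fun s hs => hanti ht (ht.trans hs) hs
  have hpos : ∀ t, 0 ≤ t → 0 < f t := fun t ht =>
    (hnonneg (t + 1) (by linarith)).trans_lt
      (hs (mem_Ici.2 ht) (mem_Ici.2 (by linarith)) (by linarith))
  have hstrict : StrictAnti fun t : ENNReal => if t = ⊤ then 0 else f t.toReal := by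
    intro s t hst
    have hs' : s ≠ ⊤ := hst.ne_top
    by_cases ht : t = ⊤
    · simpa [ht, hs'] using hpos _ ENNReal.toReal_nonneg
    · simpa [ht, hs'] using hs (mem_Ici.2 ENNReal.toReal_nonneg)
        (mem_Ici.2 ENNReal.toReal_nonneg) ((ENNReal.toReal_lt_toReal hs' ht).2 hst)
  refine ⟨fun t => ?_, ?_, hstrict.antitone, by simp [h0], by simp, hstrict.strictAntiOn _⟩
  · by_cases ht : t = ⊤
    · simp [ht]
    · simp only [ht, if_false]
      exact ⟨hnonneg _ ENNReal.toReal_nonneg, h0 ▸ hanti self_mem_Ici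
        (mem_Ici.2 ENNReal.toReal_nonneg) ENNReal.toReal_nonneg⟩
  · rw [continuous_iff_continuousAt]
    intro t
    by_cases ht : t = ⊤
    · subst ht
      rw [ContinuousAt, if_pos rfl, Metric.tendsto_nhds]
      intro ε hε
      obtain ⟨a, ha0, ha⟩ : ∃ a, 0 ≤ a ∧ f a < ε :=
        ((eventually_ge_atTop 0).and (hl.eventually_lt_const hε)).exists
      filter_upwards [lt_mem_nhds (ENNReal.ofReal_lt_top (r := a))] with t ht
      by_cases ht' : t = ⊤
      · simpa [ht'] using hε
      · have h1 : a ≤ t.toReal := by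
          rw [← ENNReal.ofReal_le_iff_le_toReal ht']
          exact ht.le
        have h2 := hanti (mem_Ici.2 ha0) (mem_Ici.2 ENNReal.toReal_nonneg) h1
        simp only [ht', if_false, Real.dist_eq, sub_zero]
        rw [abs_of_nonneg (hnonneg _ ENNReal.toReal_nonneg)]
        linarith
    · have h1 : Tendsto (fun s : ENNReal => f s.toReal) (𝓝 t) (𝓝 (f t.toReal)) := by
        refine (hc t.toReal (mem_Ici.2 ENNReal.toReal_nonneg)).tendsto.comp ?_
        exact tendsto_nhdsWithin_iff.2 ⟨ENNReal.tendsto_toReal ht,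
          Eventually.of_forall fun s => mem_Ici.2 ENNReal.toReal_nonneg⟩
      rw [ContinuousAt, if_neg ht]
      refine h1.congr' ?_
      filter_upwards [isOpen_ne.mem_nhds ht] with s hs
      rw [if_neg hs]

lemma onReal_gen (a : Family) (θ : ℝ) {t : ℝ} (ht : 0 ≤ t) : onReal (gen a θ) t = genReal a θ t := by
  simp [onReal, gen, ENNReal.toReal_ofReal ht]

/-- The properties of a strictly decreasing completely monotonic generator, for the explicit form
of the families. -/
structure IsStrictCMGen (a : Family) (θ : ℝ) : Prop where
  map_zero : genReal a θ 0 = 1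
  strictAntiOn : StrictAntiOn (genReal a θ) (Ici 0)
  tendsto : Tendsto (genReal a θ) atTop (𝓝 0)
  cm : ∀ n, CMn n (genReal a θ)

lemma IsStrictCMGen.mem {a : Family} {θ : ℝ} (h : IsStrictCMGen a θ) : gen a θ ∈ CMGenerators := by
  have hc : ContinuousOn (genReal a θ) (Ici 0) := fun t ht => by
    obtain ⟨-, g, hg, -⟩ := h.cm 1
    exact (hg t ht).continuousWithinAt
  exact ⟨isGenerator_of_real h.map_zero hc h.strictAntiOn h.tendsto,
    CMn.isCM fun n => (h.cm n).congr fun t ht => onReal_gen a θ ht⟩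

lemma IsStrictCMGen.pos {a : Family} {θ : ℝ} (h : IsStrictCMGen a θ) {t : ℝ} (ht : 0 ≤ t) :
    0 < genReal a θ t :=
  ((h.cm 0).nonneg (t := t + 1) (by linarith)).trans_lt
    (h.strictAntiOn (mem_Ici.2 ht) (mem_Ici.2 (by linarith)) (by linarith))

lemma isStrictCMGen_A {θ : ℝ} (h0 : 0 ≤ θ) (h1 : θ < 1) : IsStrictCMGen .A θ := by
  have h1' : 0 < 1 - θ := by linarith
  refine IsStrictCMGen.mk ?_ ?_ ?_ fun n => ?_
  · simp only [genReal, Real.exp_zero]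
    exact div_self h1'.ne'
  · intro s hs t ht hst
    have := exp_sub_pos h1 hs
    exact div_lt_div_of_pos_left h1' this (by linarith [Real.exp_lt_exp.2 hst])
  · exact Tendsto.const_div_atTop (tendsto_atTop_add_const_right _ (-θ) Real.tendsto_exp_atTop) _
  · refine (((CMn.const n h1'.le).mul (CMn.exp_neg n)).mul
      (CMn.exp_div_exp_sub h0 h1 n)).congr fun t ht => ?_
    have := exp_sub_pos h1 ht
    simp only [genReal, Real.exp_neg]
    field_simp

lemma isStrictCMGen_C {θ : ℝ} (h0 : 0 < θ) : IsStrictCMGen .C θ := by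
  have h1 : 0 < 1 / θ := by positivity
  refine IsStrictCMGen.mk (by simp [genReal]) ?_ ?_ fun n => ?_
  · intro s hs t ht hst
    have : (0 : ℝ) ≤ s := hs
    exact Real.rpow_lt_rpow_of_neg (by positivity) (by linarith) (by linarith)
  · exact (tendsto_rpow_neg_atTop h1).comp (tendsto_atTop_add_const_left _ 1 tendsto_id)
  · exact (CMn.rpow n one_pos h1.le).congr fun t _ => by simp only [genReal, add_comm]

lemma one_le_log_add_exp_one {t : ℝ} (ht : 0 ≤ t) : 1 ≤ Real.log (t + Real.exp 1) := by
  rw [Real.le_log_iff_exp_le (by positivity)]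
  linarith

lemma le_log_add_exp (θ : ℝ) {t : ℝ} (ht : 0 ≤ t) : θ ≤ Real.log (t + Real.exp θ) := by
  rw [Real.le_log_iff_exp_le (by positivity)]
  linarith

/-- The reciprocal of the generator is 1 + (log(t + exp θ) - θ)/θ, that is 1 plus a Bernstein
function. -/
lemma isStrictCMGen_N19 {θ : ℝ} (h0 : 0 < θ) : IsStrictCMGen .N19 θ := by
  refine IsStrictCMGen.mk ?_ ?_ ?_ fun n => ?_
  · simp [genReal, h0.ne']
  · intro s hs t ht hst
    have hs' : (0 : ℝ) ≤ s := hs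
    have := le_log_add_exp θ hs
    exact div_lt_div_of_pos_left h0 (by linarith)
      (Real.log_lt_log (by positivity) (by linarith))
  · exact Tendsto.const_div_atTop (Real.tendsto_log_atTop.comp
      (tendsto_atTop_add_const_right _ _ tendsto_id)) _
  · refine (((HasCMDeriv.log_add (Real.exp_pos θ)).const_mul
      (inv_pos.2 h0).le).comp_rpow zero_le_one n).congr fun t ht => ?_
    have := le_log_add_exp θ ht
    have h2 : 0 < Real.log (t + Real.exp θ) := by linarith
    simp only [genReal, Real.log_exp, Real.rpow_neg_one]
    rw [← inv_div]
    congr 1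
    field_simp
    ring

lemma isStrictCMGen_N20 {θ : ℝ} (h0 : 0 < θ) : IsStrictCMGen .N20 θ := by
  have h1 : 0 < 1 / θ := by positivity
  refine IsStrictCMGen.mk (by simp [genReal]) ?_ ?_ fun n => ?_
  · intro s hs t ht hst
    have hs' : (0 : ℝ) ≤ s := hs
    have := one_le_log_add_exp_one hs
    exact Real.rpow_lt_rpow_of_neg (by linarith)
      (Real.log_lt_log (by positivity) (by linarith)) (by linarith)
  · exact (tendsto_rpow_neg_atTop h1).comp (Real.tendsto_log_atTop.comp
      (tendsto_atTop_add_const_right _ _ tendsto_id))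
  · refine ((HasCMDeriv.log_add (Real.exp_pos 1)).comp_rpow h1.le n).congr fun t ht => ?_
    simp [genReal]

/-! ### Nestable pairs -/

lemma IsStrictCMGen.genInv_gen {a : Family} {θ : ℝ} (h : IsStrictCMGen a θ) {t : ℝ} (ht : 0 ≤ t) :
    genInv (gen a θ) (genReal a θ t) = ENNReal.ofReal t := by
  have : {u | gen a θ u = genReal a θ t} = {ENNReal.ofReal t} := by
    ext u
    simp only [mem_ofPred_eq, mem_singleton_iff, gen]
    constructor
    · intro hu'
      by_cases hu : u = ⊤
      · rw [if_pos hu] at hu'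
        exact absurd hu' (h.pos ht).ne
      · rw [if_neg hu] at hu'
        rw [← h.strictAntiOn.injOn (mem_Ici.2 ENNReal.toReal_nonneg) (mem_Ici.2 ht) hu',
          ENNReal.ofReal_toReal hu]
    · rintro rfl
      simp [ENNReal.toReal_ofReal ht]
  rw [genInv, this, sInf_singleton]

/-- Since ψ₁ is injective, verifying ψ₁ ∘ h = ψ₂ for a guessed h ≥ 0 identifies h with ψ₁⁻¹ ∘ ψ₂,
and no inverse has to be computed. -/
lemma nestable_of_hasCMDeriv {a₁ a₂ : Family} {θ₁ θ₂ : ℝ} (h₁ : IsStrictCMGen a₁ θ₁)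
    (h₂ : IsStrictCMGen a₂ θ₂) {h h' : ℝ → ℝ} (H : HasCMDeriv h h')
    (heq : ∀ t, 0 ≤ t → genReal a₁ θ₁ (h t) = genReal a₂ θ₂ t) :
    (gen a₁ θ₁, gen a₂ θ₂) ∈ NestablePairs := by
  have e : ∀ t, 0 ≤ t → genComp (gen a₁ θ₁) (gen a₂ θ₂) t = h t := fun t ht => by
    rw [genComp, onReal_gen a₂ θ₂ ht, ← heq t ht, h₁.genInv_gen (H.nonneg ht),
      ENNReal.toReal_ofReal (H.nonneg ht)]
  have hd : ∀ t, 0 ≤ t → HasDerivWithinAt (genComp (gen a₁ θ₁) (gen a₂ θ₂)) (h' t) (Ici 0) t :=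
    fun t ht => (H.deriv t ht).congr (fun x hx => e x hx) (e t ht)
  exact ⟨h₁.mem, h₂.mem, fun t ht => (hd t ht).differentiableWithinAt,
    CMn.isCM fun n => (H.cm n).congr fun t ht => (hd t ht).derivWithin (uniqueDiffOn_Ici 0 t ht)⟩

/-- Family A as the parent of a generator whose reciprocal has a completely monotonic derivative. -/
lemma nestable_A_of_inv {a : Family} {θ₁ θ₂ : ℝ} (h0 : 0 ≤ θ₁) (h1 : θ₁ < 1)
    (h₂ : IsStrictCMGen a θ₂) {u u' : ℝ → ℝ} (H : HasCMDeriv u u')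
    (hu : ∀ t, 0 ≤ t → genReal a θ₂ t = (u t + 1)⁻¹) :
    (gen .A θ₁, gen a θ₂) ∈ NestablePairs := by
  have h1' : 0 < 1 - θ₁ := by linarith
  -- The inverse of the A generator is y ↦ log((1 - θ₁)/y + θ₁), which at y = 1/(u + 1) equals
  -- log((1 - θ₁)u + 1).
  refine nestable_of_hasCMDeriv (isStrictCMGen_A h0 h1) h₂ (H.const_mul h1'.le).log_one_add
    fun t ht => ?_
  have := H.nonneg ht
  rw [hu t ht]
  simp only [genReal]
  rw [Real.exp_log (by positivity), ← one_div,
    show (1 - θ₁) * u t + 1 - θ₁ = (1 - θ₁) * (u t + 1) by ring]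
  field_simp

/-- Family C as the parent of a generator a power of whose reciprocal has a completely monotonic
derivative. -/
lemma nestable_C_of_rpow {a : Family} {θ₁ θ₂ q : ℝ} (h0 : 0 < θ₁) (h₂ : IsStrictCMGen a θ₂)
    {u u' : ℝ → ℝ} (H : HasCMDeriv u u') (hq : 0 < q) (hq1 : q ≤ 1)
    (hu : ∀ t, 0 ≤ t → genReal a θ₂ t = (u t + 1) ^ (-(q / θ₁))) :
    (gen .C θ₁, gen a θ₂) ∈ NestablePairs := by
  refine nestable_of_hasCMDeriv (isStrictCMGen_C h0) h₂ (H.rpow hq.le hq1) fun t ht => ?_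
  have := H.nonneg ht
  rw [hu t ht]
  simp only [genReal, add_sub_cancel]
  rw [← Real.rpow_mul (by positivity)]
  congr 1
  ring

lemma nestable_A_A {θ₁ θ₂ : ℝ} (h0 : 0 ≤ θ₁) (h12 : θ₁ ≤ θ₂) (h1 : θ₂ < 1) :
    (gen .A θ₁, gen .A θ₂) ∈ NestablePairs := by
  have h1' : 0 < 1 - θ₁ := by linarith
  have h2' : 0 < 1 - θ₂ := by linarith
  -- Solving ψ₁(h) = ψ₂ gives exp h = (exp t - k)/(1 - k) with exactly this k.
  set k := (θ₂ - θ₁) / (1 - θ₁) with hk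
  have hk0 : 0 ≤ k := div_nonneg (by linarith) h1'.le
  have hk1 : k < 1 := by rw [hk, div_lt_one h1']; linarith
  have hk2 : 1 - k = (1 - θ₂) / (1 - θ₁) := by rw [hk]; field_simp; ring
  refine nestable_of_hasCMDeriv (isStrictCMGen_A h0 (by linarith))
    (isStrictCMGen_A (by linarith) h1) (HasCMDeriv.log_exp_sub hk0 hk1) fun t ht => ?_
  have e1 := exp_sub_pos hk1 ht
  have e2 := exp_sub_pos h1 ht
  simp only [genReal]
  rw [Real.exp_sub, Real.exp_log e1, Real.exp_log (by linarith), hk2]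
  have : (Real.exp t - k) / ((1 - θ₂) / (1 - θ₁)) - θ₁ =
      (1 - θ₁) * (Real.exp t - θ₂) / (1 - θ₂) := by
    rw [hk]; field_simp; ring
  rw [this]
  field_simp

lemma genReal_C_eq (θ t : ℝ) : genReal .C θ t = (t + 1) ^ (-(1 / θ)) := by
  simp only [genReal, add_comm]

lemma nestable_A_C {θ₁ θ₂ : ℝ} (h0 : 0 ≤ θ₁) (h1 : θ₁ < 1) (h2 : 1 ≤ θ₂) :
    (gen .A θ₁, gen .C θ₂) ∈ NestablePairs := by
  refine nestable_A_of_inv h0 h1 (isStrictCMGen_C (by linarith))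
    (HasCMDeriv.id.rpow (q := 1 / θ₂) (by positivity) ((div_le_one (by linarith)).2 h2))
    fun t ht => ?_
  rw [genReal_C_eq, Real.rpow_neg (by positivity), sub_add_cancel]

lemma nestable_C_C {θ₁ θ₂ : ℝ} (h0 : 0 < θ₁) (h12 : θ₁ ≤ θ₂) :
    (gen .C θ₁, gen .C θ₂) ∈ NestablePairs := by
  have h2 : 0 < θ₂ := by linarith
  refine nestable_C_of_rpow h0 (isStrictCMGen_C h2) HasCMDeriv.id (q := θ₁ / θ₂)
    (by positivity) ((div_le_one h2).2 h12) fun t ht => ?_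
  rw [genReal_C_eq]
  congr 1
  field_simp

lemma genReal_N19_eq {θ : ℝ} (hθ : 0 < θ) {t : ℝ} :
    genReal .N19 θ t = (θ⁻¹ * (Real.log (t + Real.exp θ) - Real.log (Real.exp θ)) + 1)⁻¹ := by
  simp only [genReal, Real.log_exp]
  rw [← inv_div]
  congr 1
  field_simp
  ring

lemma nestable_A_N19 {θ₁ θ₂ : ℝ} (h0 : 0 ≤ θ₁) (h1 : θ₁ < 1) (h2 : 0 < θ₂) :
    (gen .A θ₁, gen .N19 θ₂) ∈ NestablePairs :=
  nestable_A_of_inv h0 h1 (isStrictCMGen_N19 h2)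
    ((HasCMDeriv.log_add (Real.exp_pos θ₂)).const_mul (inv_pos.2 h2).le)
    fun _ _ => genReal_N19_eq h2

/-- The generator of family 19 is (u + 1)^(-1) with u Bernstein, so the exponent q of the criterion
is θ₁ itself; this is why C is allowed only up to parameter 1. -/
lemma nestable_C_N19 {θ₁ θ₂ : ℝ} (h0 : 0 < θ₁) (h1 : θ₁ ≤ 1) (h2 : 0 < θ₂) :
    (gen .C θ₁, gen .N19 θ₂) ∈ NestablePairs :=
  nestable_C_of_rpow h0 (isStrictCMGen_N19 h2)
    ((HasCMDeriv.log_add (Real.exp_pos θ₂)).const_mul (inv_pos.2 h2).le) h0 h1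
    fun t _ => by rw [genReal_N19_eq h2, div_self h0.ne', Real.rpow_neg_one]

lemma nestable_N19_N19 {θ₁ θ₂ : ℝ} (h0 : 0 < θ₁) (h12 : θ₁ ≤ θ₂) :
    (gen .N19 θ₁, gen .N19 θ₂) ∈ NestablePairs := by
  have h2 : 0 < θ₂ := by linarith
  -- Here h = (t + exp θ₂)^q - exp θ₁ with q = θ₁/θ₂, and exp θ₁ is the q-th power of exp θ₂.
  refine nestable_of_hasCMDeriv (isStrictCMGen_N19 h0) (isStrictCMGen_N19 h2)
    (HasCMDeriv.rpow_add (Real.exp_pos θ₂) (q := θ₁ / θ₂) (by positivity)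
      ((div_le_one h2).2 h12)) fun t ht => ?_
  have := le_log_add_exp θ₂ ht
  have h3 : 0 < Real.log (t + Real.exp θ₂) := by linarith
  simp only [genReal]
  rw [← Real.exp_mul, mul_div_cancel₀ _ h2.ne', sub_add_cancel,
    Real.log_rpow (by positivity)]
  field_simp

lemma nestable_A_N20 {θ₁ θ₂ : ℝ} (h0 : 0 ≤ θ₁) (h1 : θ₁ < 1) (h2 : 1 ≤ θ₂) :
    (gen .A θ₁, gen .N20 θ₂) ∈ NestablePairs := by
  refine nestable_A_of_inv h0 h1 (isStrictCMGen_N20 (by linarith))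
    ((HasCMDeriv.log_add (Real.exp_pos 1)).rpow (q := 1 / θ₂) (by positivity)
      ((div_le_one (by linarith)).2 h2)) fun t ht => ?_
  have := one_le_log_add_exp_one ht
  simp only [genReal, Real.log_exp, sub_add_cancel]
  rw [Real.rpow_neg (by linarith)]

lemma nestable_C_N20 {θ₁ θ₂ : ℝ} (h0 : 0 < θ₁) (h12 : θ₁ ≤ θ₂) :
    (gen .C θ₁, gen .N20 θ₂) ∈ NestablePairs := by
  have h2 : 0 < θ₂ := by linarith
  refine nestable_C_of_rpow h0 (isStrictCMGen_N20 h2) (HasCMDeriv.log_add (Real.exp_pos 1))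
    (q := θ₁ / θ₂) (by positivity) ((div_le_one h2).2 h12) fun t ht => ?_
  simp only [genReal, Real.log_exp, sub_add_cancel]
  congr 1
  field_simp

end

section

open Set Filter Topology MeasureTheory Polynomial

/-! ### Laplace transforms of `s ^ (q - 1)` times a polynomial -/

/-- The value of `∫₀^∞ s ^ (q - 1) P(s) exp(-x s) ds`. -/
def gammaMoment (q : ℝ) (P : ℝ[X]) (x : ℝ) : ℝ :=
  P.sum fun j c => c * (Real.Gamma (q + j) * x ^ (-(q + j)))

lemma gammaMoment_add (q : ℝ) (P Q : ℝ[X]) (x : ℝ) :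
    gammaMoment q (P + Q) x = gammaMoment q P x + gammaMoment q Q x :=
  Polynomial.sum_add_index _ _ _ (fun _ => by simp) (fun _ _ _ => by ring)

lemma gammaMoment_monomial (q : ℝ) (j : ℕ) (c x : ℝ) :
    gammaMoment q (monomial j c) x = c * (Real.Gamma (q + j) * x ^ (-(q + j))) :=
  Polynomial.sum_monomial_index _ _ (by simp)

lemma gammaMoment_C_mul (q c : ℝ) (P : ℝ[X]) (x : ℝ) :
    gammaMoment q (C c * P) x = c * gammaMoment q P x := by
  induction P using Polynomial.induction_on' with
  | add P Q hP hQ => rw [mul_add, gammaMoment_add, gammaMoment_add, hP, hQ, mul_add]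
  | monomial j a => rw [C_mul_monomial, gammaMoment_monomial, gammaMoment_monomial]; ring

lemma gammaMoment_mul_X (q : ℝ) (P : ℝ[X]) (x : ℝ) :
    gammaMoment q (P * X) x = gammaMoment (q + 1) P x := by
  induction P using Polynomial.induction_on' with
  | add P Q hP hQ => rw [add_mul, gammaMoment_add, gammaMoment_add, hP, hQ]
  | monomial j a =>
    rw [monomial_mul_X, gammaMoment_monomial, gammaMoment_monomial]
    push_cast
    rw [show q + (j + 1 : ℝ) = q + 1 + j by ring]

/-- Differentiation in x multiplies the density by -s, which raises q by one. The closed form on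
monomials and Γ(y + 1) = yΓ(y) avoid differentiating under the integral. -/
lemma hasDerivAt_gammaMoment {q : ℝ} (hq : 0 < q) (P : ℝ[X]) {x : ℝ} (hx : 0 < x) :
    HasDerivAt (gammaMoment q P) (-gammaMoment (q + 1) P x) x := by
  induction P using Polynomial.induction_on' with
  | add P Q hP hQ =>
    convert! hP.add hQ using 1
    · ext y; exact gammaMoment_add q P Q y
    · rw [gammaMoment_add]; ring
  | monomial j a =>
    have h := ((Real.hasDerivAt_rpow_const (p := -(q + j)) (Or.inl hx.ne')).const_mul
      (Real.Gamma (q + j))).const_mul a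
    convert! h using 1
    · ext y; exact gammaMoment_monomial q j a y
    · rw [gammaMoment_monomial, show q + 1 + (j : ℝ) = q + j + 1 by ring,
        Real.Gamma_add_one (by positivity), show -(q + (j : ℝ)) - 1 = -(q + j + 1) by ring]
      ring

lemma integral_rpow_mul_eval_mul_exp {q : ℝ} (hq : 0 < q) (P : ℝ[X]) {x : ℝ} (hx : 0 < x) :
    IntegrableOn (fun s => s ^ (q - 1) * (P.eval s * Real.exp (-(x * s)))) (Ioi 0) ∧
      ∫ s in Ioi 0, s ^ (q - 1) * (P.eval s * Real.exp (-(x * s))) = gammaMoment q P x := by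
  induction P using Polynomial.induction_on' with
  | add P Q hP hQ =>
    have e : (fun s => s ^ (q - 1) * ((P + Q).eval s * Real.exp (-(x * s)))) =
        fun s => s ^ (q - 1) * (P.eval s * Real.exp (-(x * s))) +
          s ^ (q - 1) * (Q.eval s * Real.exp (-(x * s))) := by
      ext s; rw [eval_add]; ring
    rw [e, gammaMoment_add, ← hP.2, ← hQ.2]
    exact ⟨hP.1.add hQ.1, integral_add hP.1 hQ.1⟩
  | monomial j a =>
    have hqj : 0 < q + j := by positivity
    have key := Real.integral_rpow_mul_exp_neg_mul_Ioi hqj hx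
    -- A non-integrable function has integral 0 by convention, so the nonzero Gamma value forces
    -- integrability.
    have hint : IntegrableOn (fun s : ℝ => s ^ (q + j - 1) * Real.exp (-(x * s))) (Ioi 0) :=
      .of_integral_ne_zero (by
        rw [key]
        have := Real.Gamma_pos_of_pos hqj
        positivity)
    have e : EqOn (fun s => s ^ (q - 1) * ((monomial j a).eval s * Real.exp (-(x * s))))
        (fun s => a * (s ^ (q + j - 1) * Real.exp (-(x * s)))) (Ioi 0) := by
      intro s hs
      have hs' : (0 : ℝ) < s := hs
      simp only [eval_monomial]
      rw [show q + j - 1 = q - 1 + j by ring, Real.rpow_add hs', Real.rpow_natCast]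
      ring
    refine ⟨(integrableOn_congr_fun e measurableSet_Ioi).2 (hint.const_mul a), ?_⟩
    rw [setIntegral_congr_fun measurableSet_Ioi e, integral_const_mul, key, gammaMoment_monomial,
      one_div, Real.inv_rpow hx.le, Real.rpow_neg hx.le]
    ring

/-! ### The polynomials `∏ₘ (1 + s / m)` -/

/-- The polynomial `∏ (1 + s / m)`, `m = 1, …, k`. -/
def risingPoly : ℕ → ℝ[X]
  | 0 => 1
  | k + 1 => risingPoly k + C ((k + 1 : ℝ)⁻¹) * (risingPoly k * X)

lemma eval_risingPoly_succ (k : ℕ) (s : ℝ) :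
    (risingPoly (k + 1)).eval s = (risingPoly k).eval s * (1 + s / (k + 1)) := by
  simp only [risingPoly, eval_add, eval_mul, eval_C, eval_X]
  ring

lemma eval_risingPoly_pos (k : ℕ) {s : ℝ} (hs : 0 ≤ s) : 0 < (risingPoly k).eval s := by
  induction k with
  | zero => simp [risingPoly]
  | succ k ih => rw [eval_risingPoly_succ]; positivity

/-- The product is (s + 1)⋯(s + k)/k!, so shifting s by one trades the factor s + 1 for s + k + 1.
-/
lemma eval_risingPoly_add_one (k : ℕ) (s : ℝ) :
    (s + 1) * (risingPoly k).eval (s + 1) = (s + k + 1) * (risingPoly k).eval s := by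
  induction k with
  | zero => simp [risingPoly]
  | succ k ih =>
    have hk : (k + 1 : ℝ) ≠ 0 := by positivity
    rw [eval_risingPoly_succ, eval_risingPoly_succ, ← mul_assoc, ih]
    push_cast
    field_simp
    ring

lemma eval_risingPoly_le (k : ℕ) {s : ℝ} (hs : 0 ≤ s) :
    (risingPoly k).eval s ≤ Real.exp (s * harmonic k) := by
  induction k with
  | zero => simp [risingPoly]
  | succ k ih =>
    rw [eval_risingPoly_succ, harmonic_succ]
    push_cast
    rw [mul_add s, Real.exp_add]
    refine mul_le_mul ih ?_ (by positivity) (Real.exp_pos _).le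
    have := Real.add_one_le_exp (s * (k + 1 : ℝ)⁻¹)
    rw [div_eq_mul_inv]
    linarith

lemma gammaMoment_risingPoly_succ (q : ℝ) (k : ℕ) (x : ℝ) :
    gammaMoment q (risingPoly (k + 1)) x =
      gammaMoment q (risingPoly k) x + (k + 1 : ℝ)⁻¹ * gammaMoment (q + 1) (risingPoly k) x := by
  rw [risingPoly, gammaMoment_add, gammaMoment_C_mul, gammaMoment_mul_X]

/-- Dropping s ≤ 1 from the second integral and shifting by 1 turns its density sP(s) into (s + k +
1)P(s) exp(-x), which is at least P(s) once exp x ≤ k + 1. -/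
lemma gammaMoment_one_le_two {k : ℕ} {x : ℝ} (hx : 0 < x) (hk : Real.exp x ≤ k + 1) :
    gammaMoment 1 (risingPoly k) x ≤ gammaMoment 2 (risingPoly k) x := by
  obtain ⟨i1, e1⟩ := integral_rpow_mul_eval_mul_exp one_pos (risingPoly k) hx
  obtain ⟨i2, e2⟩ := integral_rpow_mul_eval_mul_exp two_pos (risingPoly k) hx
  have hshift := (measurePreserving_add_right volume (1 : ℝ)).setIntegral_preimage_emb
    (measurableEmbedding_addRight 1)
    (fun s : ℝ => s ^ ((2 : ℝ) - 1) * ((risingPoly k).eval s * Real.exp (-(x * s)))) (Ioi 1)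
  have hshifti := (measurePreserving_add_right volume (1 : ℝ)).integrableOn_comp_preimage
    (measurableEmbedding_addRight 1) (s := Ioi 1) |>.2
    (i2.mono_set (Ioi_subset_Ioi zero_le_one))
  have hpre : (fun s : ℝ => s + 1) ⁻¹' Ioi 1 = Ioi 0 := by ext s; simp
  rw [hpre] at hshift hshifti
  rw [← e1, ← e2]
  refine le_trans ?_ (setIntegral_mono_set i2 ?_ (Ioi_subset_Ioi zero_le_one).eventuallyLE)
  · rw [← hshift]
    refine setIntegral_mono_on i1 hshifti measurableSet_Ioi fun s hs => ?_
    have hs' : (0 : ℝ) < s := hs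
    have hP := eval_risingPoly_pos k hs'.le
    rw [show (2 : ℝ) - 1 = 1 by norm_num, sub_self, Real.rpow_zero, Real.rpow_one, one_mul,
      ← mul_assoc, eval_risingPoly_add_one, show -(x * (s + 1)) = -(x * s) + -x by ring,
      Real.exp_add, Real.exp_neg x]
    have h1 : 1 ≤ (s + k + 1) * (Real.exp x)⁻¹ := by
      rw [← div_eq_mul_inv, one_le_div (Real.exp_pos x)]
      linarith
    have h2 : 0 < (risingPoly k).eval s * Real.exp (-(x * s)) := by positivity
    nlinarith
  · refine (ae_restrict_iff' measurableSet_Ioi).2 (ae_of_all _ fun s hs => ?_)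
    have hs' : (0 : ℝ) < s := hs
    have hP := eval_risingPoly_pos k hs'.le
    positivity

/-- Bernoulli's inequality s^p ≤ 1 + p(s - 1), integrated against the positive weight. -/
lemma gammaMoment_one_add_le {k : ℕ} {p x : ℝ} (hp : 0 < p) (hp1 : p < 1) (hx : 0 < x) :
    gammaMoment (1 + p) (risingPoly k) x ≤
      p * gammaMoment 2 (risingPoly k) x + (1 - p) * gammaMoment 1 (risingPoly k) x := by
  obtain ⟨i1, e1⟩ := integral_rpow_mul_eval_mul_exp one_pos (risingPoly k) hx
  obtain ⟨i2, e2⟩ := integral_rpow_mul_eval_mul_exp two_pos (risingPoly k) hx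
  obtain ⟨i3, e3⟩ := integral_rpow_mul_eval_mul_exp (q := 1 + p) (by linarith) (risingPoly k) hx
  rw [← e1, ← e2, ← e3, ← integral_const_mul, ← integral_const_mul,
    ← integral_add (i2.const_mul p) (i1.const_mul (1 - p))]
  refine setIntegral_mono_on i3 ((i2.const_mul p).add (i1.const_mul (1 - p))) measurableSet_Ioi
    fun s hs => ?_
  have hs' : (0 : ℝ) < s := hs
  have hP := eval_risingPoly_pos k hs'.le
  have h2 : 0 < (risingPoly k).eval s * Real.exp (-(x * s)) := by positivity
  rw [show (2 : ℝ) - 1 = 1 by norm_num, sub_self, Real.rpow_zero, Real.rpow_one,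
    show 1 + p - 1 = p by ring]
  have h3 := rpow_one_add_le_one_add_mul_self (s := s - 1) (by linarith) hp.le hp1.le
  rw [show 1 + (s - 1) = s by ring] at h3
  nlinarith

/-- After replacing c by 1, the integrand is p(s^(p-1) - 1) times a positive weight, hence
nonpositive for s > 1. On (0, 1] the weight is at most exp(s(harmonic k - x)) ≤ exp s ≤ 1 + 2s, and
the resulting majorant integrates to at most 1. -/
lemma gammaMoment_sub_le_one {k : ℕ} {p c x : ℝ} (hp : 0 < p) (hp1 : p < 1) (hc : c ≤ 1)
    (hx : 0 < x) (hk : harmonic k ≤ 1 + x) :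
    p * c * gammaMoment p (risingPoly k) x - p * gammaMoment 1 (risingPoly k) x ≤ 1 := by
  obtain ⟨i1, e1⟩ := integral_rpow_mul_eval_mul_exp one_pos (risingPoly k) hx
  obtain ⟨i2, e2⟩ := integral_rpow_mul_eval_mul_exp hp (risingPoly k) hx
  rw [← e1, ← e2, ← integral_const_mul, ← integral_const_mul,
    ← integral_sub (i2.const_mul _) (i1.const_mul _)]
  -- This is p(s^(p-1) - 1)(1 + 2s) expanded; its integral over (0, 1] is 1 + 2p/(p + 1) - 2p ≤ 1.
  let G : ℝ → ℝ := fun s => p * s ^ (p - 1) + 2 * p * s ^ p - (p + 2 * p * s)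
  have I1 : IntervalIntegrable (fun s : ℝ => s ^ (p - 1)) volume 0 1 :=
    intervalIntegral.intervalIntegrable_rpow' (by linarith)
  have I2 : IntervalIntegrable (fun s : ℝ => s ^ p) volume 0 1 :=
    intervalIntegral.intervalIntegrable_rpow' (by linarith)
  have I3 : IntervalIntegrable (fun s : ℝ => p + 2 * p * s) volume 0 1 :=
    (by fun_prop : Continuous fun s : ℝ => p + 2 * p * s).intervalIntegrable 0 1
  have I12 := (I1.const_mul p).add (I2.const_mul (2 * p))
  have hG : ∫ s in Ioc (0 : ℝ) 1, G s ≤ 1 := by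
    rw [← intervalIntegral.integral_of_le zero_le_one]
    simp only [G]
    rw [intervalIntegral.integral_sub I12 I3,
      intervalIntegral.integral_add (I1.const_mul p) (I2.const_mul (2 * p)),
      intervalIntegral.integral_const_mul, intervalIntegral.integral_const_mul,
      integral_rpow (Or.inl (by linarith)), integral_rpow (Or.inl (by linarith)),
      intervalIntegral.integral_add (by simp) (by
        exact (by fun_prop : Continuous fun s : ℝ => 2 * p * s).intervalIntegrable 0 1),
      intervalIntegral.integral_const_mul, integral_id]
    simp only [sub_add_cancel, Real.one_rpow, Real.zero_rpow hp.ne',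
      Real.zero_rpow (by linarith : p + 1 ≠ 0), intervalIntegral.integral_const]
    have h1 : 2 * p * ((1 - 0) / (p + 1)) ≤ 2 * p := by
      rw [sub_zero, mul_one_div, div_le_iff₀ (by linarith)]
      nlinarith
    have h2 : p * ((1 - 0) / p) = 1 := by field_simp; ring
    rw [h2]
    norm_num
    norm_num at h1
    linarith
  have iG : IntegrableOn G (Ioc 0 1) :=
    (intervalIntegrable_iff_integrableOn_Ioc_of_le zero_le_one).1 (I12.sub I3)
  refine le_trans ?_ hG
  -- The two domains differ, so both integrals are extended by 0 and compared pointwise.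
  rw [← integral_indicator measurableSet_Ioc, ← integral_indicator measurableSet_Ioi]
  refine integral_mono ((integrable_indicator_iff measurableSet_Ioi).2
    ((i2.const_mul _).sub (i1.const_mul _))) ((integrable_indicator_iff measurableSet_Ioc).2 iG)
    fun s => ?_
  by_cases hs : 0 < s
  swap
  · rw [indicator_of_notMem (by simpa using hs), indicator_of_notMem (by simp [hs])]
  have hP := eval_risingPoly_pos k hs.le
  have hw : 0 < (risingPoly k).eval s * Real.exp (-(x * s)) := by positivity
  have hrp : 0 < s ^ (p - 1) := Real.rpow_pos_of_pos hs _
  rw [indicator_of_mem (mem_Ioi.2 hs), sub_self, Real.rpow_zero]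
  have h1 : p * c * (s ^ (p - 1) * ((risingPoly k).eval s * Real.exp (-(x * s)))) -
      p * (1 * ((risingPoly k).eval s * Real.exp (-(x * s)))) ≤
      (p * s ^ (p - 1) - p) * ((risingPoly k).eval s * Real.exp (-(x * s))) := by
    have : p * c * (s ^ (p - 1) * ((risingPoly k).eval s * Real.exp (-(x * s)))) ≤
      p * 1 * (s ^ (p - 1) * ((risingPoly k).eval s * Real.exp (-(x * s)))) := by gcongr
    linarith
  refine h1.trans ?_
  by_cases hs1 : s ≤ 1
  · rw [indicator_of_mem (mem_Ioc.2 ⟨hs, hs1⟩)]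
    have h2 : 1 ≤ s ^ (p - 1) := Real.one_le_rpow_of_pos_of_le_one_of_nonpos hs hs1 (by linarith)
    have h3 : (risingPoly k).eval s * Real.exp (-(x * s)) ≤ 1 + 2 * s := by
      have hk' : (harmonic k : ℝ) ≤ 1 + x := hk
      calc (risingPoly k).eval s * Real.exp (-(x * s))
          ≤ Real.exp (s * harmonic k) * Real.exp (-(x * s)) := by
            gcongr; exact eval_risingPoly_le k hs.le
        _ = Real.exp (s * (harmonic k - x)) := by rw [← Real.exp_add]; ring_nf
        _ ≤ Real.exp s := Real.exp_le_exp.2 (by nlinarith)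
        _ ≤ 1 + 2 * s := by
            have := Real.abs_exp_sub_one_sub_id_le (x := s) (by rw [abs_of_pos hs]; exact hs1)
            have := (abs_le.1 this).2
            nlinarith
    calc (p * s ^ (p - 1) - p) * ((risingPoly k).eval s * Real.exp (-(x * s)))
        ≤ (p * s ^ (p - 1) - p) * (1 + 2 * s) := by
          refine mul_le_mul_of_nonneg_left h3 ?_
          nlinarith
      _ = G s := by
          simp only [G]
          rw [Real.rpow_sub_one hs.ne']
          field_simp
  · rw [indicator_of_notMem (by simp [hs1])]
    have h2 : s ^ (p - 1) ≤ 1 := Real.rpow_le_one_of_one_le_of_nonpos (by linarith) (by linarith)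
    exact mul_nonpos_of_nonpos_of_nonneg (by nlinarith) hw.le

/-- By convexity Γ lies above its tangent at 1, whose slope is minus Euler's constant, and that
constant is below 1. -/
lemma one_sub_le_Gamma_one_add {p : ℝ} (hp : 0 < p) : 1 - p ≤ Real.Gamma (1 + p) := by
  have h := Real.convexOn_Gamma.le_slope_of_hasDerivAt (x := 1) (y := 1 + p)
    (by simp) (mem_Ioi.2 (by linarith)) (by linarith) Real.hasDerivAt_Gamma_one
  rw [slope_def_field, Real.Gamma_one, le_div_iff₀ (by linarith)] at h
  have := Real.eulerMascheroniConstant_lt_two_thirds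
  nlinarith

/-! ### The exponent belonging to family 20 -/

/-- The operators `∏ (1 - m⁻¹ d/dx)`, `m = 1, …, k`, applied to `1 + p / x - (1 - p) x ^ (-p)`. -/
def twentyAux (p : ℝ) (k : ℕ) (x : ℝ) : ℝ :=
  1 + p * gammaMoment 1 (risingPoly k) x -
    p * ((1 - p) / Real.Gamma (1 + p)) * gammaMoment p (risingPoly k) x

/-- Minus the derivative of `twentyAux`. -/
def twentyAuxDeriv (p : ℝ) (k : ℕ) (x : ℝ) : ℝ :=
  p * gammaMoment 2 (risingPoly k) x -
    p * ((1 - p) / Real.Gamma (1 + p)) * gammaMoment (1 + p) (risingPoly k) x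

lemma hasDerivAt_twentyAux {p : ℝ} (hp : 0 < p) (k : ℕ) {x : ℝ} (hx : 0 < x) :
    HasDerivAt (twentyAux p k) (-twentyAuxDeriv p k x) x := by
  have h1 := (hasDerivAt_gammaMoment one_pos (risingPoly k) hx).const_mul p
  have h2 := (hasDerivAt_gammaMoment hp (risingPoly k) hx).const_mul
    (p * ((1 - p) / Real.Gamma (1 + p)))
  convert! (h1.const_add 1).sub h2 using 1
  rw [twentyAuxDeriv, show (1 : ℝ) + 1 = 2 by norm_num, add_comm p 1]
  ring

lemma twentyAux_succ (p : ℝ) (k : ℕ) (x : ℝ) :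
    twentyAux p (k + 1) x = twentyAux p k x + (k + 1 : ℝ)⁻¹ * twentyAuxDeriv p k x := by
  simp only [twentyAux, twentyAuxDeriv, gammaMoment_risingPoly_succ]
  rw [show (1 : ℝ) + 1 = 2 by norm_num, add_comm p 1]
  ring

lemma twentyAux_zero {p : ℝ} (hp : 0 < p) (x : ℝ) :
    twentyAux p 0 x = 1 + p * x⁻¹ - (1 - p) * x ^ (-p) := by
  have h1 : (1 : ℝ[X]) = monomial 0 1 := by simp
  have hG := Real.Gamma_pos_of_pos hp
  rw [twentyAux, risingPoly, h1, gammaMoment_monomial, gammaMoment_monomial, add_comm 1 p,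
    Real.Gamma_add_one hp.ne']
  simp only [Nat.cast_zero, add_zero, Real.Gamma_one, Real.rpow_neg_one]
  field_simp

/-- While harmonic k ≤ 1 + x the constant 1 absorbs the negative part of the Laplace integral. Once
harmonic (k + 1) > 1 + x, the bound harmonic (k + 1) ≤ 1 + log(k + 1) gives exp x ≤ k + 1; then the
increment from k to k + 1 is nonnegative and induction applies. -/
lemma twentyAux_nonneg {p : ℝ} (hp : 0 < p) (hp1 : p < 1) {x : ℝ} (hx : 0 < x) (k : ℕ) :
    0 ≤ twentyAux p k x := by
  have hG : 0 < Real.Gamma (1 + p) := Real.Gamma_pos_of_pos (by linarith)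
  have hc : (1 - p) / Real.Gamma (1 + p) ≤ 1 := (div_le_one hG).2 (one_sub_le_Gamma_one_add hp)
  have direct : ∀ k : ℕ, (harmonic k : ℝ) ≤ 1 + x → 0 ≤ twentyAux p k x := fun k hk => by
    have := gammaMoment_sub_le_one hp hp1 hc hx hk
    rw [twentyAux]
    linarith
  induction k with
  | zero => exact direct 0 (by simp; linarith)
  | succ k ih =>
    by_cases hk : (harmonic (k + 1) : ℝ) ≤ 1 + x
    · exact direct _ hk
    · have h1 := harmonic_le_one_add_log (k + 1)
      have h2 : x < Real.log (k + 1 : ℕ) := by linarith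
      have h3 : Real.exp x ≤ k + 1 := by
        rw [Real.lt_log_iff_exp_lt (by positivity)] at h2
        push_cast at h2
        exact h2.le
      have h4 := gammaMoment_one_le_two hx h3
      have h5 := gammaMoment_one_add_le (k := k) hp hp1 hx
      have h6 : 0 ≤ gammaMoment (1 + p) (risingPoly k) x := by
        rw [← (integral_rpow_mul_eval_mul_exp (q := 1 + p) (by linarith) (risingPoly k) hx).2]
        refine setIntegral_nonneg measurableSet_Ioi fun s hs => ?_
        have hs' : (0 : ℝ) < s := hs
        have hP := eval_risingPoly_pos k hs'.le
        positivity
      have h7 : 0 ≤ twentyAuxDeriv p k x := by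
        have h8 : (1 - p) / Real.Gamma (1 + p) * gammaMoment (1 + p) (risingPoly k) x ≤
            gammaMoment (1 + p) (risingPoly k) x := mul_le_of_le_one_left h6 hc
        have h9 : gammaMoment (1 + p) (risingPoly k) x ≤ gammaMoment 2 (risingPoly k) x := by
          nlinarith
        rw [twentyAuxDeriv, mul_assoc, ← mul_sub]
        exact mul_nonneg hp.le (by linarith)
      rw [twentyAux_succ]
      positivity

/-- With x = log(t + e), d/dt is exp(-x) d/dx. Hence minus the derivative of the k-th function is
the (k + 1)-st, and nonnegativity for every k is complete monotonicity. -/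
lemma CMn.twentyAux {p : ℝ} (hp : 0 < p) (hp1 : p < 1) (n k : ℕ) :
    CMn n fun t => k.factorial * ((t + Real.exp 1) ^ (k + 1))⁻¹ *
      twentyAux p k (Real.log (t + Real.exp 1)) := by
  have hnn : ∀ k : ℕ, ∀ t : ℝ, 0 ≤ t → 0 ≤ k.factorial * ((t + Real.exp 1) ^ (k + 1))⁻¹ *
      HAC.twentyAux p k (Real.log (t + Real.exp 1)) := fun k t ht => by
    have h1 := one_le_log_add_exp_one ht
    have h2 := twentyAux_nonneg hp hp1 (x := Real.log (t + Real.exp 1)) (by linarith) k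
    positivity
  induction n generalizing k with
  | zero => exact hnn k
  | succ n ih =>
    refine ⟨hnn k, _, fun t ht => ?_, ih (k + 1)⟩
    have h1 := one_le_log_add_exp_one ht
    have hz : 0 < t + Real.exp 1 := by positivity
    have d0 : HasDerivAt (fun t => t + Real.exp 1) 1 t := (hasDerivAt_id t).add_const _
    have d1 := (hasDerivAt_twentyAux hp k (x := Real.log (t + Real.exp 1)) (by linarith)).comp t
      (d0.log hz.ne')
    have d2 : HasDerivAt (fun y => (k.factorial : ℝ) * ((y + Real.exp 1) ^ (k + 1))⁻¹)
        (k.factorial * (-((k + 1) * (t + Real.exp 1) ^ k) / ((t + Real.exp 1) ^ (k + 1)) ^ 2)) t := by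
      convert! ((d0.fun_pow (k + 1)).fun_inv (pow_pos hz _).ne').const_mul (k.factorial : ℝ) using 1
      push_cast
      simp
    convert! (d2.mul d1).hasDerivWithinAt using 1
    rw [twentyAux_succ, Nat.factorial_succ]
    push_cast
    simp only [Function.comp]
    generalize t + Real.exp 1 = z at hz ⊢
    field_simp
    ring

/-- The function `exp(log(t + e) ^ a) - e` has a completely monotonic derivative for `a ≤ 1`. -/
lemma HasCMDeriv.exp_log_rpow {a : ℝ} (ha : 0 < a) (ha1 : a < 1) :
    HasCMDeriv (fun t => Real.exp (Real.log (t + Real.exp 1) ^ a) - Real.exp 1)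
      (fun t => a * Real.exp (-(Real.log (t + Real.exp 1) +
        (1 - a) * Real.log (Real.log (t + Real.exp 1)) - Real.log (t + Real.exp 1) ^ a))) := by
  refine ⟨by simp, fun t ht => ?_, fun n => (CMn.const n ha.le).mul ?_⟩
  · have h1 := one_le_log_add_exp_one ht
    have hz : 0 < t + Real.exp 1 := by positivity
    have d0 : HasDerivAt (fun t => t + Real.exp 1) 1 t := (hasDerivAt_id t).add_const _
    have d1 := (((d0.log hz.ne').rpow_const (p := a) (Or.inl (by linarith))).exp.sub_const
      (Real.exp 1)).hasDerivWithinAt (s := Ici 0)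
    convert! d1 using 1
    have hL : 0 < Real.log (t + Real.exp 1) := by linarith
    rw [neg_sub, Real.exp_sub, Real.exp_add, Real.exp_log hz, mul_comm (1 - a),
      ← Real.rpow_def_of_pos hL, show a - 1 = -(1 - a) by ring, Real.rpow_neg hL.le]
    have := Real.rpow_pos_of_pos hL (1 - a)
    field_simp
  -- Minus the logarithmic derivative of this exponential is the case k = 0 of `CMn.twentyAux` with
  -- p = 1 - a.
  · refine CMn.of_logDeriv (fun t _ => (Real.exp_pos _).le) (fun t ht => ?_)
      (fun n => CMn.twentyAux (p := 1 - a) (by linarith) (by linarith) n 0) n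
    have h1 := one_le_log_add_exp_one ht
    have hL : 0 < Real.log (t + Real.exp 1) := by linarith
    have hz : 0 < t + Real.exp 1 := by positivity
    have d0 : HasDerivAt (fun t => t + Real.exp 1) 1 t := (hasDerivAt_id t).add_const _
    have d1 := d0.log hz.ne'
    have d2 := ((d1.add ((d1.log hL.ne').const_mul (1 - a))).sub
      (d1.rpow_const (p := a) (Or.inl hL.ne'))).neg.exp
    convert! d2.hasDerivWithinAt (s := Ici 0) using 1
    rw [twentyAux_zero (by linarith), show -(1 - a) = a - 1 by ring]
    simp
    field_simp
    ring

lemma nestable_N20_N20 {θ₁ θ₂ : ℝ} (h0 : 0 < θ₁) (h12 : θ₁ ≤ θ₂) :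
    (gen .N20 θ₁, gen .N20 θ₂) ∈ NestablePairs := by
  -- Equal parameters give the identity; the exponent a = θ₁/θ₂ has to be strictly below 1
  -- afterwards.
  rcases h12.eq_or_lt with rfl | h12
  · exact nestable_of_hasCMDeriv (isStrictCMGen_N20 h0) (isStrictCMGen_N20 h0) HasCMDeriv.id
      fun _ _ => rfl
  have h2 : 0 < θ₂ := by linarith
  refine nestable_of_hasCMDeriv (isStrictCMGen_N20 h0) (isStrictCMGen_N20 h2)
    (HasCMDeriv.exp_log_rpow (a := θ₁ / θ₂) (by positivity) ((div_lt_one h2).2 h12)) fun t ht => ?_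
  have h1 := one_le_log_add_exp_one ht
  simp only [genReal, sub_add_cancel, Real.log_exp]
  rw [← Real.rpow_mul (by linarith)]
  congr 1
  field_simp

end

section

open Set

/-! ### The estimated structure is a binary tree -/

lemma mem_children {E : Finset (ℕ × ℕ)} {v w : ℕ} : w ∈ children E v ↔ (v, w) ∈ E := by
  simp [children]

/-- The invariants of the structure estimation after `k` loops. -/
structure StructInv (d k : ℕ) (s : StructState) : Prop where
  active_mem : ∀ v ∈ s.active, 1 ≤ v ∧ v ≤ d + k
  active_card : s.active.card + k = d
  last : 0 < k → d + k ∈ s.active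
  edge : ∀ u w, (u, w) ∈ s.edges → d < u ∧ u ≤ d + k ∧ 1 ≤ w ∧ w < u ∧ w ∉ s.active
  parent : ∀ v, 1 ≤ v → v ≤ d + k → v ∉ s.active → ∃! u, (u, v) ∈ s.edges
  children_eq : ∀ u, d < u → u ≤ d + k → ∃ a b, a < b ∧ children s.edges u = {a, b}

lemma StructInv.succ {d k : ℕ} {s : StructState} (h : StructInv d k s) (hk : k + 1 < d)
    (T : ℕ → ℕ → ℝ) {selPair : ℕ → Set (ℕ × ℕ) → ℕ × ℕ} (hsel : IsSelection selPair) :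
    StructInv d (k + 1) (structStep d T selPair (k + 1) s) := by
  -- All that matters about the maximization is that it selects two distinct active nodes; a
  -- maximizer exists because there are finitely many pairs, and at least one.
  obtain ⟨i, j, hi, hj, hij, hs⟩ : ∃ i j, i ∈ s.active ∧ j ∈ s.active ∧ i < j ∧
      (structStep d T selPair (k + 1) s).active = (s.active ∪ {d + (k + 1)}) \ {i, j} ∧
      (structStep d T selPair (k + 1) s).edges =
        s.edges ∪ {(d + (k + 1), i), (d + (k + 1), j)} := by
    let D : ℕ × ℕ → ℝ := fun p => avg T (leavesBelow d s.edges p.1) (leavesBelow d s.edges p.2)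
    let cand : Set (ℕ × ℕ) := {p | p.1 ∈ s.active ∧ p.2 ∈ s.active ∧ p.1 < p.2}
    have hfin : cand.Finite := (s.active ×ˢ s.active).finite_toSet.subset fun p hp => by
      simpa using ⟨hp.1, hp.2.1⟩
    have hne : cand.Nonempty := by
      have : 1 < s.active.card := by have := h.active_card; omega
      obtain ⟨x, hx, y, hy, hxy⟩ := Finset.one_lt_card.1 this
      rcases lt_or_gt_of_ne hxy with hlt | hlt
      · exact ⟨(x, y), hx, hy, hlt⟩
      · exact ⟨(y, x), hy, hx, hlt⟩
    obtain ⟨m, hm, hmax⟩ := exists_max_image cand D hfin hne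
    have := (hsel (k + 1) {p | p ∈ cand ∧ ∀ q ∈ cand, D q ≤ D p} ⟨m, hm, hmax⟩).1
    exact ⟨_, _, this.1, this.2.1, this.2.2, rfl, rfl⟩
  obtain ⟨hsa, hse⟩ := hs
  have hi' := h.active_mem i hi
  have hj' := h.active_mem j hj
  have hnew : d + (k + 1) ∉ s.active := fun hc => by have := h.active_mem _ hc; omega
  have hmemA : ∀ v, v ∈ (structStep d T selPair (k + 1) s).active ↔
      (v ∈ s.active ∨ v = d + (k + 1)) ∧ v ≠ i ∧ v ≠ j := fun v => by
    rw [hsa]; simp; tauto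
  have hmemE : ∀ u w, (u, w) ∈ (structStep d T selPair (k + 1) s).edges ↔
      (u, w) ∈ s.edges ∨ (u = d + (k + 1) ∧ (w = i ∨ w = j)) := fun u w => by
    rw [hse]; simp; tauto
  refine ⟨fun v hv => ?_, ?_, fun _ => ?_, fun u w huw => ?_, fun v hv1 hv2 hva => ?_,
    fun u hu1 hu2 => ?_⟩
  · rcases ((hmemA v).1 hv).1 with hv | rfl
    · have := h.active_mem v hv; omega
    · omega
  · have h1 : ({i, j} : Finset ℕ) ⊆ s.active ∪ {d + (k + 1)} := by
      intro v hv
      simp only [Finset.mem_insert, Finset.mem_singleton] at hv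
      rcases hv with rfl | rfl <;> simp [hi, hj]
    have h2 : (s.active ∪ {d + (k + 1)}).card = s.active.card + 1 := by
      rw [Finset.card_union_of_disjoint (by simpa using hnew), Finset.card_singleton]
    have h3 := Finset.card_sdiff_of_subset h1
    rw [Finset.card_pair hij.ne, h2] at h3
    rw [hsa]
    have := h.active_card
    omega
  · rw [hmemA]; omega
  · rw [hmemA]
    rcases (hmemE u w).1 huw with huw | ⟨rfl, rfl | rfl⟩
    · have := h.edge u w huw
      refine ⟨by omega, by omega, by omega, by omega, ?_⟩
      rintro ⟨hw | hw, -⟩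
      · exact this.2.2.2.2 hw
      · omega
    · exact ⟨by omega, by omega, by omega, by omega, fun hc => hc.2.1 rfl⟩
    · exact ⟨by omega, by omega, by omega, by omega, fun hc => hc.2.2 rfl⟩
  · simp only [hmemE]
    by_cases hvs : v ∈ s.active
    · have hvij : v = i ∨ v = j := by
        by_contra hc
        push Not at hc
        exact hva ((hmemA v).2 ⟨Or.inl hvs, hc⟩)
      refine ⟨d + (k + 1), Or.inr ⟨rfl, hvij⟩, ?_⟩
      rintro u (hu | hu)
      · exact absurd hvs (h.edge u v hu).2.2.2.2
      · exact hu.1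
    · have hvk : v ≠ d + (k + 1) := by
        rintro rfl
        exact hva ((hmemA _).2 ⟨Or.inr rfl, by omega, by omega⟩)
      obtain ⟨u, hu, huu⟩ := h.parent v hv1 (by omega) hvs
      refine ⟨u, Or.inl hu, ?_⟩
      rintro u' (hu' | ⟨-, rfl | rfl⟩)
      · exact huu u' hu'
      · exact absurd hi hvs
      · exact absurd hj hvs
  · by_cases hu : u = d + (k + 1)
    · refine ⟨i, j, hij, ?_⟩
      ext w
      rw [mem_children, hmemE]
      simp only [hu, true_and, Finset.mem_insert, Finset.mem_singleton, or_iff_right_iff_imp]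
      intro hc
      have := h.edge _ _ hc
      omega
    · obtain ⟨a, b, hab, he⟩ := h.children_eq u hu1 (by omega)
      refine ⟨a, b, hab, ?_⟩
      rw [← he]
      ext w
      rw [mem_children, mem_children, hmemE]
      simp [hu]

lemma structInv_structRun {d : ℕ} (T : ℕ → ℕ → ℝ)
    {selPair : ℕ → Set (ℕ × ℕ) → ℕ × ℕ} (hsel : IsSelection selPair) {k : ℕ} (hk : k < d) :
    StructInv d k (structRun d T selPair k) := by
  induction k with
  | zero =>
    refine ⟨fun v hv => ?_, ?_, fun h => absurd h (lt_irrefl 0), fun u w h => ?_,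
      fun v h1 h2 h3 => ?_, fun u h1 h2 => ?_⟩
    · simpa [structRun] using hv
    · simp [structRun]
    · simp [structRun] at h
    · simp [structRun] at h3
      omega
    · omega
  | succ k ih => exact (ih (by omega)).succ hk T hsel

lemma StructInv.isBinaryTree {d : ℕ} (hd : 2 ≤ d) {s : StructState} (h : StructInv d (d - 1) s) :
    IsBinaryTree d (Finset.Icc 1 (2 * d - 1)) s.edges := by
  have e : d + (d - 1) = 2 * d - 1 := by omega
  have hact : s.active = {2 * d - 1} := by
    obtain ⟨x, hx⟩ := Finset.card_eq_one.1 (show s.active.card = 1 by have := h.active_card; omega)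
    have := h.last (by omega)
    rw [hx, Finset.mem_singleton, e] at this
    rw [hx, this]
  have hparent : ∀ v ∈ Finset.Icc 1 (2 * d - 1), v ≠ 2 * d - 1 → ∃! u, (u, v) ∈ s.edges := by
    intro v hv hv'
    rw [Finset.mem_Icc] at hv
    exact h.parent v hv.1 (by omega) (by simpa [hact] using hv')
  refine ⟨rfl, fun p hp => ?_, fun u hu => ?_, hparent, ?_, fun v hv => ?_, fun v hv => ?_⟩
  · have := h.edge p.1 p.2 hp
    simp only [Finset.mem_product, Finset.mem_Icc]
    omega
  · have := h.edge _ _ hu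
    omega
  · have key : ∀ m v, 2 * d - 1 - v ≤ m → v ∈ Finset.Icc 1 (2 * d - 1) →
        Relation.ReflTransGen (fun x y => (x, y) ∈ s.edges) (2 * d - 1) v := by
      intro m
      induction m with
      | zero =>
        intro v hm hv
        rw [Finset.mem_Icc] at hv
        rw [show v = 2 * d - 1 by omega]
      | succ m ih =>
        intro v hm hv
        by_cases hv' : v = 2 * d - 1
        · rw [hv']
        · obtain ⟨u, hu, -⟩ := hparent v hv hv'
          have := h.edge u v hu
          rw [Finset.mem_Icc] at hv
          exact (ih u (by omega) (Finset.mem_Icc.2 (by omega))).tail hu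
    exact fun v hv => key _ v le_rfl hv
  · rw [Finset.mem_Icc] at hv
    refine Finset.eq_empty_of_forall_notMem fun w hw => ?_
    have := h.edge v w (mem_children.1 hw)
    omega
  · rw [Finset.mem_Icc] at hv
    obtain ⟨a, b, hab, he⟩ := h.children_eq v (by omega) (by omega)
    rw [he, Finset.card_pair hab.ne]

/-! ### The parameter intervals met by the algorithm -/

/-- The parameter interval of a family in `N0`. -/
def leafRange : Family → Set ℝ
  | .A => Ico 0 1
  | .C => Ici 1
  | .N19 => Ioi 0
  | .N20 => Ici 1

/-- The least parameter of a family that trimming can return. -/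
def leastParam (M : MachineReals) : Family → ℝ
  | .A => 0
  | .C => 1
  | .N19 => M.next 0
  | .N20 => 1

/-- The parameter intervals that occur in the algorithm: the interval in `N0`, or the part of it
below a parameter. -/
def IsAdmissible (M : MachineReals) (a : Family) (r : Set ℝ) : Prop :=
  r = leafRange a ∨ ∃ β ∈ leafRange a, leastParam M a ≤ β ∧ r = leafRange a ∩ Iic β

lemma isStrictCMGen_of_mem_leafRange {a : Family} {θ : ℝ} (h : θ ∈ leafRange a) :
    IsStrictCMGen a θ := by
  cases a with
  | A => exact isStrictCMGen_A h.1 h.2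
  | C => exact isStrictCMGen_C (one_pos.trans_le h)
  | N19 => exact isStrictCMGen_N19 h
  | N20 => exact isStrictCMGen_N20 (one_pos.trans_le h)

lemma IsAdmissible.subset {M : MachineReals} {a : Family} {r : Set ℝ} (h : IsAdmissible M a r) :
    r ⊆ leafRange a := by
  rcases h with rfl | ⟨β, -, -, rfl⟩
  · exact subset_rfl
  · exact inter_subset_left

lemma IsAdmissible.inter {M : MachineReals} {a : Family} {r₁ r₂ : Set ℝ}
    (h₁ : IsAdmissible M a r₁) (h₂ : IsAdmissible M a r₂) : IsAdmissible M a (r₁ ∩ r₂) := by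
  rcases h₁ with rfl | ⟨β₁, hβ₁, hl₁, rfl⟩
  · rw [inter_eq_self_of_subset_right h₂.subset]
    exact h₂
  · rcases h₂ with rfl | ⟨β₂, hβ₂, hl₂, rfl⟩
    · rw [inter_eq_self_of_subset_left inter_subset_left]
      exact Or.inr ⟨β₁, hβ₁, hl₁, rfl⟩
    · refine Or.inr ⟨min β₁ β₂, ?_, le_min hl₁ hl₂, ?_⟩
      · rcases min_choice β₁ β₂ with h | h <;> rwa [h]
      · rw [← inter_inter_distrib_left, Iic_inter_Iic]

lemma leafRange_inter_Iic_A {β : ℝ} (h : β ∈ leafRange .A) :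
    leafRange .A ∩ Iic β = Icc 0 β := by
  ext x
  have := h.2
  simp only [leafRange, mem_inter_iff, mem_Ico, mem_Iic, mem_Icc]
  exact ⟨fun hx => ⟨hx.1.1, hx.2⟩, fun hx => ⟨⟨hx.1, by linarith [hx.2]⟩, hx.2⟩⟩

lemma IsAdmissible.mem_ranges {M : MachineReals} {a : Family} {r : Set ℝ}
    (h : IsAdmissible M a r) : r ∈ ranges := by
  rcases h with rfl | ⟨β, hβ, -, rfl⟩
  · cases a with
    | A => exact ⟨0, le_rfl, Or.inr (Or.inr ⟨1, zero_le_one, by simp [leafRange]⟩)⟩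
    | C => exact ⟨1, zero_le_one, Or.inl rfl⟩
    | N19 => exact ⟨0, le_rfl, Or.inr (Or.inl rfl)⟩
    | N20 => exact ⟨1, zero_le_one, Or.inl rfl⟩
  · cases a with
    | A => exact ⟨0, le_rfl, Or.inr (Or.inr ⟨β, hβ.1, Or.inl (leafRange_inter_Iic_A hβ)⟩)⟩
    | C => exact ⟨1, zero_le_one, Or.inr (Or.inr ⟨β, hβ, Or.inl rfl⟩)⟩
    | N19 =>
      have hβ' : (0 : ℝ) < β := hβ
      exact ⟨0, le_rfl, Or.inr (Or.inr ⟨β, hβ'.le, Or.inr (Or.inl rfl)⟩)⟩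
    | N20 => exact ⟨1, zero_le_one, Or.inr (Or.inr ⟨β, hβ, Or.inl rfl⟩)⟩

lemma MachineReals.next_zero (M : MachineReals) : 0 < M.next 0 := by
  have h : (M.carrier.filter fun y => 0 < y).Nonempty :=
    ⟨1, Finset.mem_filter.2 ⟨M.one_mem, one_pos⟩⟩
  rw [MachineReals.next, dif_pos h]
  exact (Finset.mem_filter.1 (Finset.min'_mem _ h)).2

lemma MachineReals.prev_one (M : MachineReals) : M.prev 1 ∈ Ico 0 1 := by
  have h0 : 0 ∈ M.carrier.filter fun y => y < 1 := Finset.mem_filter.2 ⟨M.zero_mem, one_pos⟩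
  have h : (M.carrier.filter fun y => y < 1).Nonempty := ⟨0, h0⟩
  rw [MachineReals.prev, dif_pos h]
  exact ⟨Finset.le_max' _ _ h0, (Finset.mem_filter.1 (Finset.max'_mem _ h)).2⟩

lemma trim_Ici (M : MachineReals) (θ α : ℝ) : α ≤ trim M θ (Ici α) := by
  simp only [trim, csInf_Ici, mem_Ici, le_refl, if_true]
  exact le_max_right _ _

lemma trim_Icc (M : MachineReals) (θ : ℝ) {α β : ℝ} (h : α ≤ β) :
    trim M θ (Icc α β) ∈ Icc α β := by
  simp only [trim, csInf_Icc h, csSup_Icc h, left_mem_Icc.2 h, right_mem_Icc.2 h, if_true,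
    bddAbove_Icc]
  exact ⟨le_max_right _ _, max_le (min_le_right _ _) h⟩

/-- The outer maximum in `trim` could push the value past β. This is excluded by `leastParam M a ≤
β`: for family 19 the open end 0 becomes `M.next 0`, which would leave (0, β] if β were smaller. The
second conclusion passes the bound on to the next cut-off. -/
lemma trim_mem {M : MachineReals} {a : Family} {r : Set ℝ} (h : IsAdmissible M a r) (θ : ℝ) :
    trim M θ r ∈ r ∧ leastParam M a ≤ trim M θ r := by
  rcases h with rfl | ⟨β, hβ, hl, rfl⟩
  · cases a with
    | A =>
      have h1 : BddAbove (Ico (0 : ℝ) 1) := bddAbove_Ico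
      have h2 := M.prev_one
      have h3 : (0 : ℝ) ∈ Ico (0 : ℝ) 1 := by simp
      have h4 : (1 : ℝ) ∉ Ico (0 : ℝ) 1 := by simp
      simp only [leafRange, leastParam, trim, csInf_Ico zero_lt_one, csSup_Ico zero_lt_one, h1, h3,
        h4, if_true, if_false]
      exact ⟨⟨le_max_right _ _, max_lt ((min_le_right _ _).trans_lt h2.2) one_pos⟩,
        le_max_right _ _⟩
    | C => exact ⟨trim_Ici M θ 1, trim_Ici M θ 1⟩
    | N19 =>
      have h3 : (0 : ℝ) ∉ Ioi (0 : ℝ) := by simp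
      simp only [leafRange, leastParam, trim, csInf_Ioi, h3, if_false]
      exact ⟨M.next_zero.trans_le (le_max_right _ _), le_max_right _ _⟩
    | N20 => exact ⟨trim_Ici M θ 1, trim_Ici M θ 1⟩
  · cases a with
    | A =>
      rw [leafRange_inter_Iic_A hβ]
      exact ⟨trim_Icc M θ hβ.1, (trim_Icc M θ hβ.1).1⟩
    | C => exact ⟨trim_Icc M θ hβ, (trim_Icc M θ hβ).1⟩
    | N19 =>
      have hβ' : (0 : ℝ) < β := hβ
      have e : leafRange .N19 ∩ Iic β = Ioc 0 β := rfl
      have h1 : BddAbove (Ioc (0 : ℝ) β) := bddAbove_Ioc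
      have h3 : (0 : ℝ) ∉ Ioc (0 : ℝ) β := by simp
      have h4 : β ∈ Ioc (0 : ℝ) β := ⟨hβ', le_rfl⟩
      rw [e]
      simp only [leastParam, trim, csInf_Ioc hβ', csSup_Ioc hβ', h1, h3, h4, if_true, if_false]
      exact ⟨⟨M.next_zero.trans_le (le_max_right _ _), max_le (min_le_right _ _) hl⟩,
        le_max_right _ _⟩
    | N20 => exact ⟨trim_Icc M θ hβ, (trim_Icc M θ hβ).1⟩

/-! ### The admissible parents -/

/-- The pairs in `N2` are admissible, after intersection with the interval in `N0`, and satisfy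
the sufficient nesting condition. -/
lemma N2_spec (M : MachineReals) {a b : Family} {θ : ℝ} (hθ : θ ∈ leafRange a)
    (hl : leastParam M a ≤ θ) {r : Set ℝ} (hr : (b, r) ∈ N2 a θ) :
    IsAdmissible M b (leafRange b ∩ r) ∧
      ∀ θ' ∈ leafRange b ∩ r, (gen b θ', gen a θ) ∈ NestablePairs := by
  have hA : IsAdmissible M .A (leafRange .A ∩ Ico 0 1) := Or.inl (inter_self _)
  have hIoc : ∀ β : ℝ, 1 ≤ β → Ici 1 ∩ Ioc 0 β = Ici 1 ∩ Iic β := fun β hβ => by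
    ext x
    simp only [mem_inter_iff, mem_Ici, mem_Ioc, mem_Iic]
    exact ⟨fun h => ⟨h.1, h.2.2⟩, fun h => ⟨h.1, by linarith [h.1], h.2⟩⟩
  cases a with
  | A =>
    simp only [N2, mem_singleton_iff, Prod.mk.injEq] at hr
    obtain ⟨rfl, rfl⟩ := hr
    refine ⟨Or.inr ⟨θ, hθ, hl, ?_⟩, fun θ' h => nestable_A_A h.1.1 h.2.2 hθ.2⟩
    rw [leafRange_inter_Iic_A hθ, inter_eq_right]
    exact fun x hx => ⟨hx.1, hx.2.trans_lt hθ.2⟩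
  | C =>
    have h1 : 1 ≤ θ := hθ
    -- Parameters of C and 20 start at 1 in `N0` and stay there, so the branch θ < 1, which does not
    -- offer family A, is never taken.
    simp only [N2, not_lt.2 h1, if_false, mem_insert_iff, mem_singleton_iff, Prod.mk.injEq] at hr
    obtain ⟨rfl, rfl⟩ | ⟨rfl, rfl⟩ := hr
    · exact ⟨hA, fun θ' h => nestable_A_C h.1.1 h.1.2 h1⟩
    · exact ⟨Or.inr ⟨θ, h1, h1, hIoc θ h1⟩, fun θ' h => nestable_C_C h.2.1 h.2.2⟩
  | N19 =>
    simp only [N2, mem_insert_iff, mem_singleton_iff, Prod.mk.injEq] at hr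
    obtain ⟨rfl, rfl⟩ | ⟨rfl, rfl⟩ | ⟨rfl, rfl⟩ := hr
    · exact ⟨hA, fun θ' h => nestable_A_N19 h.1.1 h.1.2 hθ⟩
    -- Below family 19 the interval (0, 1] of C meets [1, ∞) in the single parameter 1.
    · exact ⟨Or.inr ⟨1, self_mem_Ici, le_rfl, hIoc 1 le_rfl⟩,
        fun θ' h => nestable_C_N19 h.2.1 h.2.2 hθ⟩
    · refine ⟨Or.inr ⟨θ, hθ, hl, ?_⟩, fun θ' h => nestable_N19_N19 h.2.1 h.2.2⟩
      rw [inter_eq_right.2 fun x hx => hx.1]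
      rfl
  | N20 =>
    have h1 : 1 ≤ θ := hθ
    simp only [N2, not_lt.2 h1, if_false, mem_insert_iff, mem_singleton_iff, Prod.mk.injEq] at hr
    obtain ⟨rfl, rfl⟩ | ⟨rfl, rfl⟩ | ⟨rfl, rfl⟩ := hr
    · exact ⟨hA, fun θ' h => nestable_A_N20 h.1.1 h.1.2 h1⟩
    · exact ⟨Or.inr ⟨θ, h1, h1, hIoc θ h1⟩, fun θ' h => nestable_C_N20 h.2.1 h.2.2⟩
    · exact ⟨Or.inr ⟨θ, h1, h1, hIoc θ h1⟩, fun θ' h => nestable_N20_N20 h.2.1 h.2.2⟩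

/-- The common point is θ = 0, where the A generator is exp(-t); it keeps intersections of these
intervals nonempty. -/
lemma exists_A_mem_N2 (M : MachineReals) {a : Family} {θ : ℝ} (hθ : θ ∈ leafRange a) :
    ∃ r, (Family.A, r) ∈ N2 a θ ∧ IsAdmissible M .A r ∧ 0 ∈ r := by
  have h0 : (0 : ℝ) ∈ Ico (0 : ℝ) 1 := by simp
  cases a with
  | A => exact ⟨Icc 0 θ, rfl, Or.inr ⟨θ, hθ, hθ.1, (leafRange_inter_Iic_A hθ).symm⟩,
      left_mem_Icc.2 hθ.1⟩
  | C =>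
    have h1 : 1 ≤ θ := hθ
    exact ⟨Ico 0 1, by simp [N2, not_lt.2 h1], Or.inl rfl, h0⟩
  | N19 => exact ⟨Ico 0 1, by simp [N2], Or.inl rfl, h0⟩
  | N20 =>
    have h1 : 1 ≤ θ := hθ
    exact ⟨Ico 0 1, by simp [N2, not_lt.2 h1], Or.inl rfl, h0⟩

/-- The invariants of the sets of admissible parents. -/
structure IsAdmissibleSet (M : MachineReals) (N : Set (Family × Set ℝ)) : Prop where
  finite : N.Finite
  admissible : ∀ a r, (a, r) ∈ N → IsAdmissible M a r
  family_A : ∃ r, (Family.A, r) ∈ N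

lemma mem_N0 {a : Family} {r : Set ℝ} : (a, r) ∈ N0 ↔ r = leafRange a := by
  cases a <;> simp [N0, leafRange]

lemma isAdmissibleSet_N0 (M : MachineReals) : IsAdmissibleSet M N0 :=
  ⟨by simp [N0], fun _ _ h => Or.inl (mem_N0.1 h), _, mem_N0.2 rfl⟩

lemma finite_nestInter {N₁ N₂ : Set (Family × Set ℝ)} (h₁ : N₁.Finite) (h₂ : N₂.Finite) :
    (nestInter N₁ N₂).Finite := by
  refine ((h₁.prod h₂).image fun p => (p.1.1, p.1.2 ∩ p.2.2)).subset ?_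
  rintro ⟨a, r⟩ ⟨r₁, -, r₂, -, rfl, m₁, m₂⟩
  exact ⟨((a, r₁), (a, r₂)), ⟨m₁, m₂⟩, rfl⟩

lemma IsAdmissibleSet.nestInter {M : MachineReals} {N₁ N₂ : Set (Family × Set ℝ)}
    (h₁ : IsAdmissibleSet M N₁) (h₂ : IsAdmissibleSet M N₂) :
    IsAdmissibleSet M (nestInter N₁ N₂) := by
  refine ⟨finite_nestInter h₁.finite h₂.finite, ?_, ?_⟩
  · rintro a r ⟨r₁, -, r₂, -, rfl, m₁, m₂⟩
    exact (h₁.admissible a r₁ m₁).inter (h₂.admissible a r₂ m₂)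
  · obtain ⟨r₁, m₁⟩ := h₁.family_A
    obtain ⟨r₂, m₂⟩ := h₂.family_A
    exact ⟨r₁ ∩ r₂, r₁, (h₁.admissible _ _ m₁).mem_ranges, r₂,
      (h₂.admissible _ _ m₂).mem_ranges, rfl, m₁, m₂⟩

lemma finite_N2 (a : Family) (θ : ℝ) : (N2 a θ).Finite := by
  cases a <;> simp only [N2] <;> try split_ifs
  all_goals exact toFinite _

lemma IsAdmissibleSet.nestInter_N2 {M : MachineReals} {N : Set (Family × Set ℝ)}
    (h : IsAdmissibleSet M N) {a : Family} {θ : ℝ} (hθ : θ ∈ leafRange a)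
    (hl : leastParam M a ≤ θ) :
    IsAdmissibleSet M (HAC.nestInter N (N2 a θ)) ∧
      ∀ b r, (b, r) ∈ HAC.nestInter N (N2 a θ) → ∀ θ' ∈ r, (gen b θ', gen a θ) ∈ NestablePairs := by
  refine ⟨⟨finite_nestInter h.finite (finite_N2 a θ), ?_, ?_⟩, ?_⟩
  · rintro b r ⟨r₁, -, r₂, -, rfl, m₁, m₂⟩
    have h₁ := h.admissible b r₁ m₁
    have := h₁.inter (N2_spec M hθ hl m₂).1
    -- The interval from N already lies in the one of `N0`, so the extra intersection needed by
    -- `N2_spec` changes nothing.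
    rwa [← inter_assoc, inter_eq_self_of_subset_left h₁.subset] at this
  · obtain ⟨r₁, m₁⟩ := h.family_A
    obtain ⟨r₂, m₂, h₂, -⟩ := exists_A_mem_N2 M hθ
    exact ⟨r₁ ∩ r₂, r₁, (h.admissible _ _ m₁).mem_ranges, r₂, h₂.mem_ranges, rfl, m₁, m₂⟩
  · rintro b r ⟨r₁, -, r₂, -, rfl, m₁, m₂⟩ θ' hθ'
    exact (N2_spec M hθ hl m₂).2 θ' ⟨(h.admissible b r₁ m₁).subset hθ'.1, hθ'.2⟩

lemma exists_A_nestMem (M : MachineReals) {a₂ a₃ : Family} {θ₂ θ₃ : ℝ} (h₂ : NestMem a₂ θ₂ N0)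
    (h₃ : NestMem a₃ θ₃ N0) :
    ∃ θ₁ : ℝ, 0 ≤ θ₁ ∧ NestMem .A θ₁ (nestInter (nestInter N0 (N2 a₂ θ₂)) (N2 a₃ θ₃)) := by
  obtain ⟨s₂, -, m₂, t₂⟩ := h₂
  obtain ⟨s₃, -, m₃, t₃⟩ := h₃
  rw [mem_N0] at m₂ m₃
  subst m₂ m₃
  obtain ⟨r₂, n₂, g₂, z₂⟩ := exists_A_mem_N2 M t₂
  obtain ⟨r₃, n₃, g₃, z₃⟩ := exists_A_mem_N2 M t₃
  have g₁ : IsAdmissible M .A (leafRange .A) := Or.inl rfl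
  refine ⟨0, le_rfl, leafRange .A ∩ r₂ ∩ r₃, ((g₁.inter g₂).inter g₃).mem_ranges, ?_,
    ⟨⟨g₂.subset z₂, z₂⟩, z₃⟩⟩
  exact ⟨leafRange .A ∩ r₂, (g₁.inter g₂).mem_ranges, r₃, g₃.mem_ranges, rfl,
    ⟨leafRange .A, g₁.mem_ranges, r₂, g₂.mem_ranges, rfl, mem_N0.2 rfl, n₂⟩, n₃⟩

/-! ### The estimation of the labels -/

/-- The invariants of the heterogeneous estimation after `k` loops. -/
structure HeteroInv (M : MachineReals) (d : ℕ) (E : Finset (ℕ × ℕ)) (k : ℕ) (s : HeteroState) :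
    Prop where
  parents : ∀ v, 1 ≤ v → v ≤ d + k → IsAdmissibleSet M (s.parents v)
  lam_mem : ∀ v, d < v → v ≤ d + k → s.lam v ∈ CMGenerators
  lam_parents : ∀ v, d < v → v ≤ d + k → ∀ b r, (b, r) ∈ s.parents v → ∀ θ ∈ r,
    (gen b θ, s.lam v) ∈ NestablePairs
  nesting : ∀ v, d < v → v ≤ d + k → ∀ w ∈ children E v, d < w → w < v →
    (s.lam v, s.lam w) ∈ NestablePairs

/-- The chosen pair lies in the intersection of the children's sets, and its trimmed parameter lies
in both intervals. The invariant `lam_parents` of each child that is a fork then gives nestability,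
and `N2` restores that invariant for the new fork. -/
lemma HeteroInv.succ {M : MachineReals} {d k : ℕ} {E : Finset (ℕ × ℕ)} {s : HeteroState}
    (h : HeteroInv M d E k s)
    (hE : ∃ i j, 1 ≤ i ∧ i < j ∧ j ≤ d + k ∧ children E (d + (k + 1)) = {i, j})
    (tau : ℕ → ℝ) (stat : Finset ℕ → Finset ℕ → (ENNReal → ℝ) → NNReal) (est : Family → ℝ → ℝ)
    {selFam : ℕ → Set (Family × Set ℝ) → Family × Set ℝ} (hsel : IsSelection selFam) :
    ∃ s', heteroStep d E tau N2 stat M est selFam (k + 1) s = some s' ∧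
      HeteroInv M d E (k + 1) s' := by
  obtain ⟨i, j, hi, hij, hj, hc⟩ := hE
  have hinf : sInf (children E (d + (k + 1)) : Set ℕ) = i := by
    rw [hc, Finset.coe_pair, csInf_pair, min_eq_left hij.le]
  have hsup : sSup (children E (d + (k + 1)) : Set ℕ) = j := by
    rw [hc, Finset.coe_pair, csSup_pair, max_eq_right hij.le]
  simp only [heteroStep, hinf, hsup]
  have hN := (h.parents i hi (by omega)).nestInter (h.parents j (by omega) hj)
  have hNi : ∀ b r, (b, r) ∈ nestInter (s.parents i) (s.parents j) → ∀ θ ∈ r,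
      ∀ w, w = i ∨ w = j → d < w → (gen b θ, s.lam w) ∈ NestablePairs := by
    rintro b r ⟨r₁, -, r₂, -, rfl, m₁, m₂⟩ θ hθ w (rfl | rfl) hw
    · exact h.lam_parents _ hw (by omega) b r₁ m₁ θ hθ.1
    · exact h.lam_parents _ hw (by omega) b r₂ m₂ θ hθ.2
  generalize nestInter (s.parents i) (s.parents j) = N at hN hNi ⊢
  have hNne : N.Nonempty := let ⟨r, hr⟩ := hN.family_A; ⟨_, hr⟩
  rw [if_neg hNne.ne_empty]
  -- Only the existence of a minimizer over a finite set is needed, so the score is made opaque.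
  generalize hscore : (fun p : Family × Set ℝ => stat (leavesBelow d E i) (leavesBelow d E j)
    (gen p.1 (trim M (est p.1 (tau (d + (k + 1)))) p.2))) = score
  have hs : ∀ p : Family × Set ℝ, stat (leavesBelow d E i) (leavesBelow d E j)
    (gen p.1 (trim M (est p.1 (tau (d + (k + 1)))) p.2)) = score p := fun p => by rw [← hscore]
  simp only [hs]
  obtain ⟨m, hm, hmin⟩ := exists_min_image N score hN.finite hNne
  have hbest := (hsel (k + 1) {p | p ∈ N ∧ ∀ q ∈ N, score p ≤ score q} ⟨m, hm, hmin⟩).1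
  generalize selFam (k + 1) {p | p ∈ N ∧ ∀ q ∈ N, score p ≤ score q} = best at hbest ⊢
  obtain ⟨a, r⟩ := best
  simp only
  have hadm := hN.admissible a r hbest
  obtain ⟨hθ, hl⟩ := trim_mem hadm (est a (tau (d + (k + 1))))
  generalize trim M (est a (tau (d + (k + 1)))) r = θ at hθ hl ⊢
  have hθ' := hadm.subset hθ
  obtain ⟨hN', hnest⟩ := hN.nestInter_N2 hθ' hl
  have hNne' : nestInter N (N2 a θ) ≠ ∅ :=
    let ⟨r, hr⟩ := hN'.family_A; Set.Nonempty.ne_empty ⟨_, hr⟩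
  rw [if_neg hNne']
  refine ⟨_, rfl, fun v hv1 hv2 => ?_, fun v hv1 hv2 => ?_, fun v hv1 hv2 => ?_,
    fun v hv1 hv2 w hw hdw hwv => ?_⟩
  all_goals simp only
  · by_cases hv : v = d + (k + 1)
    · rw [hv, Function.update_self]
      exact hN'
    · rw [Function.update_of_ne hv]
      exact h.parents v hv1 (by omega)
  · by_cases hv : v = d + (k + 1)
    · rw [hv, Function.update_self]
      exact (isStrictCMGen_of_mem_leafRange hθ').mem
    · rw [Function.update_of_ne hv]
      exact h.lam_mem v hv1 (by omega)
  · by_cases hv : v = d + (k + 1)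
    · rw [hv, Function.update_self, Function.update_self]
      exact hnest
    · rw [Function.update_of_ne hv, Function.update_of_ne hv]
      exact h.lam_parents v hv1 (by omega)
  · rw [Function.update_of_ne (show w ≠ d + (k + 1) by omega)]
    by_cases hv : v = d + (k + 1)
    · rw [hv, Function.update_self]
      rw [hv, hc] at hw
      exact hNi a r hbest θ hθ w (by simpa using hw) hdw
    · rw [Function.update_of_ne hv]
      exact h.nesting v hv1 (by omega) w hw hdw hwv

lemma exists_heteroRun (M : MachineReals) {d K : ℕ} {E : Finset (ℕ × ℕ)}
    (hE : ∀ k < K, ∃ i j, 1 ≤ i ∧ i < j ∧ j ≤ d + k ∧ children E (d + (k + 1)) = {i, j})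
    (tau : ℕ → ℝ) (stat : Finset ℕ → Finset ℕ → (ENNReal → ℝ) → NNReal) (est : Family → ℝ → ℝ)
    {selFam : ℕ → Set (Family × Set ℝ) → Family × Set ℝ} (hsel : IsSelection selFam) :
    ∀ k ≤ K, ∃ s, heteroRun d E tau N0 N2 stat M est selFam k = some s ∧ HeteroInv M d E k s := by
  intro k
  induction k with
  | zero =>
    refine fun _ => ⟨_, rfl, fun v h1 h2 => ?_, fun v h1 h2 => ?_, fun v h1 h2 => ?_,
      fun v h1 h2 => ?_⟩
    · simp only
      rw [if_pos (show v ∈ Finset.Icc 1 d from Finset.mem_Icc.2 ⟨h1, h2⟩)]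
      exact isAdmissibleSet_N0 M
    all_goals omega
  | succ k ih =>
    intro hk
    obtain ⟨s, hs, h⟩ := ih (by omega)
    rw [heteroRun, hs]
    exact h.succ (hE k (by omega)) tau stat est hsel

end

end HAC

end

theorem mainTheorem3 (d n : ℕ) (hd : 2 ≤ d) (hn : 2 ≤ n)
    (U : Fin n → ℕ → ℝ)
    (g : (k : ℕ) → (Fin k → NNReal) → NNReal) (hg : HAC.IsAggregation g)
    (S : (Fin n → ℝ × ℝ) → (unitInterval → unitInterval → ℝ) → NNReal)
    (M : HAC.MachineReals) (fallback : HAC.Family → ℝ → ℝ)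
    (selPair : ℕ → Set (ℕ × ℕ) → ℕ × ℕ) (hselPair : HAC.IsSelection selPair)
    (selFam : ℕ → Set (HAC.Family × Set ℝ) → HAC.Family × Set ℝ)
    (hselFam : HAC.IsSelection selFam) :
    (∃ T : HAC.Triplet,
      HAC.heteroHAC d U HAC.N0 HAC.N2 g S M fallback selPair selFam = some T ∧
      HAC.IsBinaryTree d T.V T.E ∧
      (∀ v ∈ Finset.Icc (d + 1) (2 * d - 1), T.lam v ∈ HAC.CMGenerators) ∧
      HAC.SNC d (d - 1) T.E T.lam) ∧
    (∀ (a₂ : HAC.Family) (θ₂ : ℝ) (a₃ : HAC.Family) (θ₃ : ℝ),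
      HAC.NestMem a₂ θ₂ HAC.N0 → HAC.NestMem a₃ θ₃ HAC.N0 →
      ∃ θ₁ : ℝ, 0 ≤ θ₁ ∧
        HAC.NestMem .A θ₁
          (HAC.nestInter (HAC.nestInter HAC.N0 (HAC.N2 a₂ θ₂)) (HAC.N2 a₃ θ₃))) := by
  refine ⟨?_, fun a₂ θ₂ a₃ θ₃ => HAC.exists_A_nestMem M⟩
  have hst := HAC.structInv_structRun (HAC.sampleTau U) hselPair (show d - 1 < d by omega)
  -- Children carry smaller numbers than their fork, so both are already treated when loop k + 1
  -- labels d + (k + 1).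
  have hE : ∀ k < d - 1, ∃ i j, 1 ≤ i ∧ i < j ∧ j ≤ d + k ∧
      HAC.children (HAC.structRun d (HAC.sampleTau U) selPair (d - 1)).edges (d + (k + 1)) =
        {i, j} := by
    intro k hk
    obtain ⟨i, j, hij, he⟩ := hst.children_eq (d + (k + 1)) (by omega) (by omega)
    have hi := hst.edge _ i (HAC.mem_children.1 (he ▸ Finset.mem_insert_self i {j}))
    have hj := hst.edge _ j (HAC.mem_children.1 (by rw [he]; simp))
    exact ⟨i, j, hi.2.2.1, hij, by omega, he⟩
  obtain ⟨s, hs, hinv⟩ := HAC.exists_heteroRun M hE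
    (HAC.structRun d (HAC.sampleTau U) selPair (d - 1)).tau (HAC.aggStat U g S)
    (HAC.paramEstimate M fallback) hselFam (d - 1) le_rfl
  refine ⟨_, by rw [HAC.heteroHAC, hs]; rfl, hst.isBinaryTree hd, fun v hv => ?_,
    fun v hv w hw => ?_⟩
  · rw [Finset.mem_Icc] at hv
    exact hinv.lam_mem v (by omega) (by omega)
  · rw [Finset.mem_Icc] at hv
    rw [Finset.mem_inter, Finset.mem_Icc] at hw
    have := hst.edge v w (HAC.mem_children.1 hw.1)
    exact hinv.nesting v (by omega) (by omega) w hw.1 (by omega) (by omega)
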